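/- **Setting.** Let $X$ (always observed) and $Y$ (subject to missingness) take values in measurable spaces with $\sigma$-finite dominating measures $\nu$ and $\mu$, and let $M\in\{0,1\}$ be the missingness indicator of $Y$ ($M=1$: $Y$ is missing). A full-data density $h(x,y,m)$ is a probability density with respect to $\nu\otimes\mu\otimes$ counting measure; its observed-data density $h(x,y^*)$ is $h(x,y,0)$ when $y^*=y$ is observed and $\int h(x,y,1)\,\mu(dy)$ when $Y$ is missing. Two full-data densities are observationally equivalent if their observed-data densities agree (almost everywhere). For a density $k$, $L_1\{k\}$ is the set of measurable functions integrable against $k$; $\langle\cdot\rangle$ denotes the linear span of a set of functions. Let $h(x,y,m)$ be a full-data density with $\pi=h(M=1)\in(0,1)$, put $c=(1-\pi)/\pi$, and let $\mathcal U\subseteq L_1\{h(y)\}$ be a set of functions of $y$ (the auxiliary information consists of the values $\int u(y)h(y)\,\mu(dy)$, $u\in\mathcal U$). Let $\lambda:(0,1)\to\mathbb R$ be differentiable and strictly increasing, and suppose that $$f_\lambda(z)=\int_0^z\lambda\Big[\frac{v}{c+v}\Big]dv$$ is finite for all $z>0$ and satisfies the following growth condition: for every $t>1$ there are positive constants $t_0,t_1,t_2,t_3$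 such that $f_\lambda(tz)\le t_1f_\lambda(z)+t_2z+t_3$ for all $z>t_0$. Let $\mathcal P$ be the set of probability densities $p(x,y)$ with respect to $\nu\otimes\mu$ whose $X$-marginal is $h(x\mid M=1)$ and for which, for every $u\in\mathcal U$, $u$ is $p$-integrable with $\iint u(y)p(x,y)\,\nu(dx)\mu(dy)=\int u(y)h(y\mid M=1)\,\mu(dy)$. With $q(x,y)=h(x,y\mid M=0)$ let $I(p)=\iint f_\lambda(p/q)\,q\,d\nu\,d\mu\in(-\infty,\infty]$ for densities $p$ dominated by $q$, and $I(p)=\infty$ for all others. An $f_\lambda$-projection of $h(x,y\mid M=0)$ onto $\mathcal P$ is an element of $\mathcal P$ that minimizes $I$ over $\mathcal P$. Assume that $\inf_{p\in\mathcal P}I(p)<\infty$. **Theorem.** 1. *(Existence.)* If $\lambda(s)\to\infty$ as $s\uparrow1$ and, for every real $K$, every probability density that is a limit in variational distance of elements $p_n\in\mathcal P$ with $I(p_n)\le K$ belongs to $\mathcal P$ (in particular, if $\mathcal P$ is closed in variational distance), then an $f_\lambda$-projection exists. This closedness condition holds whenever every $u\in\mathcal U$ is bounded, and whenever $\mathcal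 U$ contains the indicator functions of all measurable sets (so that the distribution of $Y$ is known). 2. *(Uniqueness.)* Any two $f_\lambda$-projections agree $\nu\otimes\mu$-almost everywhere. 3. Let $g(x,y\mid M=1)$ be the $f_\lambda$-projection of $h(x,y\mid M=0)$ onto $\mathcal P$, let $G_1$ be the distribution with this density, and define $g(x,y,m)=\{g(x,y\mid M=1)\,\pi\}^m\{h(x,y,M=0)\}^{1-m}$. Then $g$ is a full-data density; $0<g(M=1\mid x,y)<1$ for $G_1$-almost all $(x,y)$, and $$\lambda[g(M=1\mid x,y)]\in\overline{\langle L_1\{h(x\mid M=1)\}\cup\mathcal U\rangle},$$ where the closure is taken in $L_1(G_1)$; $g(x,y^*)=h(x,y^*)$, that is, $g$ and $h$ are observationally equivalent; and, for every $u\in\mathcal U$, $u$ is integrable against $g(y)$ with $\int u(y)g(y)\,\mu(dy)=\int u(y)h(y)\,\mu(dy)$. -/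

import Mathlib

open MeasureTheory Set Filter Topology

noncomputable section

/-! ### Link functions and `f`-divergences -/

/-- A regular link function: `lam` is differentiable and (strictly) increasing on `(0,1)`.
Its values outside `(0,1)` carry no meaning. -/
structure IsRegularLink (lam : ℝ → ℝ) : Prop where
  differentiableOn : DifferentiableOn ℝ lam (Ioo 0 1)
  strictMonoOn : StrictMonoOn lam (Ioo 0 1)

/-- The function `f_lam(z) = ∫_0^z lam (v / (c + v)) dv`. -/
def fLink (lam : ℝ → ℝ) (c z : ℝ) : ℝ := ∫ v in (0 : ℝ)..z, lam (v / (c + v))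

/-- The integrals that define `f_lam(z)`, `z > 0`, converge. -/
def FLinkDefined (lam : ℝ → ℝ) (c : ℝ) : Prop :=
  ∀ z : ℝ, 0 < z → IntervalIntegrable (fun v => lam (v / (c + v))) volume 0 z

/-- The growth condition: `f` does not increase too fast at infinity. -/
def GrowthCondition (f : ℝ → ℝ) : Prop :=
  ∀ t : ℝ, 1 < t → ∃ t₀ t₁ t₂ t₃ : ℝ, 0 < t₀ ∧ 0 < t₁ ∧ 0 < t₂ ∧ 0 < t₃ ∧
    ∀ z : ℝ, t₀ < z → f (t * z) ≤ t₁ * f z + t₂ * z + t₃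

/-- `p` is a probability density with respect to `ρ`. -/
structure IsProbDensity {Z : Type*} [MeasurableSpace Z] (ρ : Measure Z) (p : Z → ℝ) : Prop where
  measurable : Measurable p
  nonneg : ∀ z, 0 ≤ p z
  integrable : Integrable p ρ
  integral_eq_one : ∫ z, p z ∂ρ = 1

/-- The distribution with density `p` with respect to `ρ`. -/
def densityMeasure {Z : Type*} [MeasurableSpace Z] (ρ : Measure Z) (p : Z → ℝ) : Measure Z :=
  ρ.withDensity (fun z => ENNReal.ofReal (p z))

open Classical in
/-- The `f`-divergence `I_f(p, q) = ∫ f(p/q) q dρ` of two probability densities, for `f` convex and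
finite at `0`. It is defined for `p` dominated by `q`, and is `⊤` if `p` is not dominated by `q`. As
`f` has an affine minorant, the integral always exists in `(-∞, ∞]`, and it is infinite exactly if
the integrand is not integrable. -/
def fDivergence {Z : Type*} [MeasurableSpace Z] (f : ℝ → ℝ) (ρ : Measure Z) (p q : Z → ℝ) : EReal :=
  if (∀ᵐ z ∂ρ, q z = 0 → p z = 0) ∧ Integrable (fun z => f (p z / q z) * q z) ρ then
    ((∫ z, f (p z / q z) * q z ∂ρ : ℝ) : EReal)
  else ⊤

/-- `p` is an `f`-projection of `q` onto the set `C` of densities: an element of `C` which minimizes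
the `f`-divergence from `q`. -/
def IsFProjection {Z : Type*} [MeasurableSpace Z] (f : ℝ → ℝ) (ρ : Measure Z) (q : Z → ℝ)
    (C : Set (Z → ℝ)) (p : Z → ℝ) : Prop :=
  p ∈ C ∧ ∀ p' ∈ C, fDivergence f ρ p q ≤ fDivergence f ρ p' q

/-- For every `K`, the part of `C` on which the divergence from `q` is at most `K` has all its
limits in variational distance in `C`. (In particular this is so if `C` is closed in variational
distance.) -/
def SublevelsClosedInVariation {Z : Type*} [MeasurableSpace Z] (f : ℝ → ℝ) (ρ : Measure Z)
    (q : Z → ℝ) (C : Set (Z → ℝ)) : Prop :=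
  ∀ (K : ℝ) (P : ℕ → Z → ℝ) (p : Z → ℝ), IsProbDensity ρ p →
    (∀ n, P n ∈ C ∧ fDivergence f ρ (P n) q ≤ (K : EReal)) →
    Tendsto (fun n => ∫ z, |P n z - p z| ∂ρ) atTop (𝓝 0) → p ∈ C

/-- `F` belongs to the closure in `L_1(P)` of the set `S` of functions. -/
def MemL1Closure {Z : Type*} [MeasurableSpace Z] (P : Measure Z) (S : Set (Z → ℝ)) (F : Z → ℝ) :
    Prop :=
  Integrable F P ∧ ∀ ε : ℝ, 0 < ε → ∃ w ∈ S, Integrable w P ∧ ∫ z, |F z - w z| ∂P < ε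

/-! ### Full-data and observed-data densities

`X` takes values in `𝓧`, `Y` in `𝓨`, with dominating measures `ν` and `μ`, and `M` takes values in
`{0,1}`; `M = 1` means that `Y` is missing. A full-data density is written `h (x, y) m`. -/

section Data

variable {𝓧 𝓨 : Type*} [MeasurableSpace 𝓧] [MeasurableSpace 𝓨]

/-- `h` is a probability density with respect to the product of `ν`, `μ` and the counting measure
on `{0,1}`. -/
structure IsFullDataDensity (ν : Measure 𝓧) (μ : Measure 𝓨) (h : 𝓧 × 𝓨 → Fin 2 → ℝ) : Prop where
  measurable : ∀ m, Measurable fun z => h z m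
  nonneg : ∀ z m, 0 ≤ h z m
  integrable : ∀ m, Integrable (fun z => h z m) (ν.prod μ)
  integral_eq_one : ∑ m, ∫ z, h z m ∂(ν.prod μ) = 1

/-- The probability `h(M = m)`. -/
def probM (ν : Measure 𝓧) (μ : Measure 𝓨) (h : 𝓧 × 𝓨 → Fin 2 → ℝ) (m : Fin 2) : ℝ :=
  ∫ z, h z m ∂(ν.prod μ)

/-- The conditional density `h(x, y ∣ M = m)`. -/
def condDensity (ν : Measure 𝓧) (μ : Measure 𝓨) (h : 𝓧 × 𝓨 → Fin 2 → ℝ) (m : Fin 2) :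
    𝓧 × 𝓨 → ℝ :=
  fun z => h z m / probM ν μ h m

/-- The `X`-marginal of a density of `(X, Y)`. -/
def margX (μ : Measure 𝓨) (p : 𝓧 × 𝓨 → ℝ) (x : 𝓧) : ℝ := ∫ y, p (x, y) ∂μ

/-- The `Y`-marginal of a density of `(X, Y)`. -/
def margY (ν : Measure 𝓧) (p : 𝓧 × 𝓨 → ℝ) (y : 𝓨) : ℝ := ∫ x, p (x, y) ∂ν

/-- The density `h(y)` of `Y` under the full-data density `h`. -/
def densityY (ν : Measure 𝓧) (h : 𝓧 × 𝓨 → Fin 2 → ℝ) : 𝓨 → ℝ :=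
  margY ν (fun z => ∑ m, h z m)

/-- The set `L_1{k}` of measurable functions that are integrable against the density `k`. -/
def L1Density {Z : Type*} [MeasurableSpace Z] (ρ : Measure Z) (k : Z → ℝ) : Set (Z → ℝ) :=
  {u | Measurable u ∧ Integrable (fun z => u z * k z) ρ}

/-- The observed-data density `h(x, y*)`: `y* = some y` if `Y = y` is observed, and `y* = none` if
`Y` is missing. -/
def obsDensity (μ : Measure 𝓨) (h : 𝓧 × 𝓨 → Fin 2 → ℝ) (x : 𝓧) : Option 𝓨 → ℝ
  | some y => h (x, y) 0
  | none => ∫ y, h (x, y) 1 ∂μ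

/-- Observational equivalence: the two observed-data densities agree almost everywhere. -/
def ObsEquivalent (ν : Measure 𝓧) (μ : Measure 𝓨) (g h : 𝓧 × 𝓨 → Fin 2 → ℝ) : Prop :=
  (∀ᵐ z ∂(ν.prod μ), obsDensity μ g z.1 (some z.2) = obsDensity μ h z.1 (some z.2)) ∧
    ∀ᵐ x ∂ν, obsDensity μ g x none = obsDensity μ h x none

/-- The missingness mechanism `g(M = 1 ∣ x, y)`. -/
def missProb (g : 𝓧 × 𝓨 → Fin 2 → ℝ) (z : 𝓧 × 𝓨) : ℝ := g z 1 / ∑ m, g z m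

/-- The set of distributions of `(X, Y)` that match the `X`-marginal `h(x ∣ M = 1)` and the
integrals `∫ u(y) h(y ∣ M = 1) μ(dy)`, `u ∈ 𝓤`. -/
def constraintSet (ν : Measure 𝓧) (μ : Measure 𝓨) (h : 𝓧 × 𝓨 → Fin 2 → ℝ) (𝓤 : Set (𝓨 → ℝ)) :
    Set (𝓧 × 𝓨 → ℝ) :=
  {p | IsProbDensity (ν.prod μ) p ∧
    (∀ᵐ x ∂ν, margX μ p x = margX μ (condDensity ν μ h 1) x) ∧
    ∀ u ∈ 𝓤, Integrable (fun y => u y * margY ν p y) μ ∧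
      ∫ y, u y * margY ν p y ∂μ = ∫ y, u y * margY ν (condDensity ν μ h 1) y ∂μ}

/-- The full-data density `g(x, y, m) = {p(x, y) π}^m {h(x, y, 0)}^(1 - m)`, `π = h(M = 1)`. -/
def buildFullData (ν : Measure 𝓧) (μ : Measure 𝓨) (h : 𝓧 × 𝓨 → Fin 2 → ℝ) (p : 𝓧 × 𝓨 → ℝ) :
    𝓧 × 𝓨 → Fin 2 → ℝ :=
  fun z m => (p z * probM ν μ h 1) ^ (m : ℕ) * (h z 0) ^ (1 - (m : ℕ))

/-- The linear span of `L_1{h(x ∣ M = 1)} ∪ 𝓤`, as functions of `(x, y)`. -/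
def additiveSpan (ν : Measure 𝓧) (μ : Measure 𝓨) (h : 𝓧 × 𝓨 → Fin 2 → ℝ) (𝓤 : Set (𝓨 → ℝ)) :
    Submodule ℝ (𝓧 × 𝓨 → ℝ) :=
  Submodule.span ℝ
    ((fun (α : 𝓧 → ℝ) (z : 𝓧 × 𝓨) => α z.1) '' L1Density ν (margX μ (condDensity ν μ h 1)) ∪
      (fun (u : 𝓨 → ℝ) (z : 𝓧 × 𝓨) => u z.2) '' 𝓤)

end Data

end

/-! Everything rests on convexity of `f = fLink lam c`: its derivative at `z > 0` is `lam (z / (c +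
z))`, which is strictly increasing, so `f` is strictly convex on `[0, ∞)`. The constraint set is
convex. Uniqueness follows: two projections with finite divergence that differ on a non-null set
would have a midpoint with smaller divergence.

For existence, `lam → ∞` makes `f` superlinear. Strict convexity then becomes quantitative
(`abs_sub_le_midpoint_gap`): `|a - b|` is bounded by a multiple of the midpoint gap plus a small
multiple of the values of `f`. Along a minimizing sequence the integrated gap tends to zero, because
midpoints stay in the set, so the sequence is Cauchy in `L¹`. Its limit lies in the set by the
closedness assumption and attains the infimum by Fatou's lemma.

For the first order condition, let `p` be the projection, `q` the density given `M = 0`, and `g` a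
bounded function that annihilates the additive span in `L¹(G₁)`. After scaling `g`, the densities `p
(1 + t g)` satisfy the constraints. Minimality for `g` and `-g` gives `∫ f'(p/q) g p = 0`, and the
choice of `c` makes `f'(p/q)` equal to `lam` of the missingness mechanism. So every bounded function
annihilating the span annihilates this function too, and Hahn-Banach with the duality of `L¹` and
`L^∞` puts it in the closure. The growth condition keeps divergences finite along the perturbations
and provides the dominating function for differentiation under the integral. -/

/-! ### Convexity and growth of `fLink` -/

section Link

variable {lam : ℝ → ℝ} {c : ℝ}

theorem div_add_mem_Ioo (hc : 0 < c) {z : ℝ} (hz : 0 < z) : z / (c + z) ∈ Ioo (0 : ℝ) 1 :=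
  ⟨by positivity, by rw [div_lt_one (by positivity)]; linarith⟩

theorem IsRegularLink.strictMonoOn_comp (hl : IsRegularLink lam) (hc : 0 < c) :
    StrictMonoOn (fun v => lam (v / (c + v))) (Ioi 0) := by
  intro a ha b hb hab
  simp only [mem_Ioi] at ha hb
  refine hl.strictMonoOn (div_add_mem_Ioo hc ha) (div_add_mem_Ioo hc hb) ?_
  rw [div_lt_div_iff₀ (by positivity) (by positivity)]
  nlinarith

theorem IsRegularLink.continuousAt_comp (hl : IsRegularLink lam) (hc : 0 < c) {z : ℝ}
    (hz : 0 < z) : ContinuousAt (fun v => lam (v / (c + v))) z := by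
  have h1 : ContinuousAt lam (z / (c + z)) :=
    hl.differentiableOn.continuousOn.continuousAt (isOpen_Ioo.mem_nhds (div_add_mem_Ioo hc hz))
  have h2 : ContinuousAt (fun v : ℝ => v / (c + v)) z := by
    apply ContinuousAt.div <;> first | fun_prop | positivity
  exact ContinuousAt.comp (f := fun v : ℝ => v / (c + v)) h1 h2

theorem fLink_zero : fLink lam c 0 = 0 := by simp [fLink]

theorem hasDerivAt_fLink (hl : IsRegularLink lam) (hc : 0 < c) (hd : FLinkDefined lam c) {z : ℝ}
    (hz : 0 < z) : HasDerivAt (fLink lam c) (lam (z / (c + z))) z := by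
  refine intervalIntegral.integral_hasDerivAt_right (hd z hz) ?_ (hl.continuousAt_comp hc hz)
  refine ContinuousOn.stronglyMeasurableAtFilter isOpen_Ioi (s := Ioi (0 : ℝ)) ?_ z hz
  exact fun v hv => (hl.continuousAt_comp hc hv).continuousWithinAt

theorem continuousOn_fLink (hl : IsRegularLink lam) (hc : 0 < c) (hd : FLinkDefined lam c) :
    ContinuousOn (fLink lam c) (Ici 0) := by
  intro z hz
  rcases (mem_Ici.1 hz).eq_or_lt with rfl | hz'
  · have h1 := hd 1 one_pos
    have h2 := intervalIntegral.continuousOn_primitive_interval'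
      (μ := volume) (f := fun v => lam (v / (c + v))) (a := 0) h1 (by simp)
    have h3 := h2 0 (by simp)
    rw [uIcc_of_le zero_le_one] at h3
    exact h3.mono_of_mem_nhdsWithin (Icc_mem_nhdsGE one_pos)
  · exact (hasDerivAt_fLink hl hc hd hz').continuousAt.continuousWithinAt

theorem strictConvexOn_fLink (hl : IsRegularLink lam) (hc : 0 < c) (hd : FLinkDefined lam c) :
    StrictConvexOn ℝ (Ici 0) (fLink lam c) := by
  refine StrictMonoOn.strictConvexOn_of_deriv (convex_Ici 0) (continuousOn_fLink hl hc hd) ?_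
  rw [interior_Ici]
  intro a ha b hb hab
  rw [(hasDerivAt_fLink hl hc hd ha).deriv, (hasDerivAt_fLink hl hc hd hb).deriv]
  exact hl.strictMonoOn_comp hc ha hb hab

/-- Tangents are taken only at `a > 0`, since `lam` may tend to `-∞` at `0`; the comparison point
may still be `0`. -/
theorem tangent_le_fLink (hl : IsRegularLink lam) (hc : 0 < c) (hd : FLinkDefined lam c) {a z : ℝ}
    (ha : 0 < a) (hz : 0 ≤ z) :
    fLink lam c a + lam (a / (c + a)) * (z - a) ≤ fLink lam c z := by
  have hconv := (strictConvexOn_fLink hl hc hd).convexOn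
  have hda := hasDerivAt_fLink hl hc hd ha
  rcases lt_trichotomy a z with h | rfl | h
  · have := hconv.le_slope_of_hasDerivAt (mem_Ici.2 ha.le) (mem_Ici.2 hz) h hda
    rw [slope_def_field, le_div_iff₀ (by linarith)] at this
    linarith
  · simp
  · have := hconv.slope_le_of_hasDerivAt (mem_Ici.2 hz) (mem_Ici.2 ha.le) h hda
    rw [slope_def_field, div_le_iff₀ (by linarith)] at this
    linarith

theorem exists_affine_le_fLink (hl : IsRegularLink lam) (hc : 0 < c) (hd : FLinkDefined lam c) :
    ∃ A B : ℝ, 0 ≤ A ∧ 0 ≤ B ∧ ∀ z, 0 ≤ z → -(A + B * z) ≤ fLink lam c z := by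
  refine ⟨|fLink lam c 1 - lam (1 / (c + 1))|, |lam (1 / (c + 1))|, abs_nonneg _, abs_nonneg _,
    fun z hz => ?_⟩
  have h1 := tangent_le_fLink hl hc hd one_pos hz
  have h2 := neg_abs_le (fLink lam c 1 - lam (1 / (c + 1)))
  have h3 := mul_le_mul_of_nonneg_right (neg_abs_le (lam (1 / (c + 1)))) hz
  linarith

/-- The tangent at `a` has slope `lam (a / (c + a))`, which exceeds any `N` for large `a`. -/
theorem fLink_superlinear (hl : IsRegularLink lam) (hc : 0 < c) (hd : FLinkDefined lam c)
    (hlim : Tendsto lam (𝓝[<] 1) atTop) (N : ℝ) :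
    ∃ B : ℝ, 0 ≤ B ∧ ∀ z, 0 ≤ z → N * z - B ≤ fLink lam c z := by
  have h1 : Tendsto (fun z : ℝ => z / (c + z)) atTop (𝓝[<] 1) := by
    refine tendsto_nhdsWithin_iff.2 ⟨?_, ?_⟩
    · have h2 : Tendsto (fun z : ℝ => 1 - c / (c + z)) atTop (𝓝 (1 - 0)) :=
        tendsto_const_nhds.sub
          (tendsto_const_nhds.div_atTop (tendsto_atTop_add_const_left _ _ tendsto_id))
      rw [sub_zero] at h2
      refine h2.congr' ?_
      filter_upwards [eventually_gt_atTop 0] with z hz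
      field_simp
      ring
    · filter_upwards [eventually_gt_atTop 0] with z hz
      exact (div_add_mem_Ioo hc hz).2
  obtain ⟨a, haN, ha⟩ := (((hlim.comp h1).eventually_ge_atTop N).and
    (eventually_gt_atTop (0 : ℝ))).exists
  refine ⟨|fLink lam c a - lam (a / (c + a)) * a|, abs_nonneg _, fun z hz => ?_⟩
  have h2 := tangent_le_fLink hl hc hd ha hz
  have h3 := neg_abs_le (fLink lam c a - lam (a / (c + a)) * a)
  have h4 := mul_le_mul_of_nonneg_right haN hz
  simp only [Function.comp] at h4
  linarith

/-- The growth condition bounds the dilations of `f` by `f` itself, up to an affine function. -/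
theorem abs_fLink_mul_le (hl : IsRegularLink lam) (hc : 0 < c) (hd : FLinkDefined lam c)
    (hg : GrowthCondition (fLink lam c)) {s : ℝ} (hs : 0 < s) :
    ∃ A B D : ℝ, 0 ≤ A ∧ 0 ≤ B ∧ 0 ≤ D ∧ ∀ z, 0 ≤ z →
      |fLink lam c (s * z)| ≤ A * |fLink lam c z| + B * z + D := by
  obtain ⟨A, B, hA, hB, hlow⟩ := exists_affine_le_fLink hl hc hd
  have hlow' : ∀ z, 0 ≤ z → -fLink lam c (s * z) ≤ B * s * z + A := fun z hz => by
    have := hlow (s * z) (by positivity)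
    linarith
  -- The growth condition covers only factors above `1`, so it is used for `s + 1`. Below `t₀`,
  -- where it says nothing, continuity on a compact interval gives the bound.
  obtain ⟨t₀, t₁, t₂, t₃, ht₀, ht₁, ht₂, ht₃, hgr⟩ := hg (s + 1) (by linarith)
  obtain ⟨b, hb⟩ := (isCompact_Icc (a := (0 : ℝ)) (b := (s + 1) * t₀)).exists_bound_of_continuousOn
    ((continuousOn_fLink hl hc hd).mono Icc_subset_Ici_self)
  have hb0 : 0 ≤ b := (norm_nonneg _).trans (hb 0 ⟨le_rfl, by positivity⟩)
  have hconv := (strictConvexOn_fLink hl hc hd).convexOn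
  have hup : ∀ z, 0 ≤ z →
      fLink lam c ((s + 1) * z) ≤ t₁ * |fLink lam c z| + t₂ * z + (t₃ + b) := fun z hz => by
    by_cases h : t₀ < z
    · have h1 := hgr z h
      have h2 := mul_le_mul_of_nonneg_left (le_abs_self (fLink lam c z)) ht₁.le
      linarith
    · have h1 := hb ((s + 1) * z) ⟨by positivity, by gcongr; linarith⟩
      have h2 := le_abs_self (fLink lam c ((s + 1) * z))
      rw [Real.norm_eq_abs] at h1
      have h3 : 0 ≤ t₁ * |fLink lam c z| := by positivity
      have h4 : 0 ≤ t₂ * z := by positivity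
      linarith
  refine ⟨t₁, t₂ + B * s, t₃ + b + A, ht₁.le, by positivity, by positivity, fun z hz => ?_⟩
  -- The point `s * z` is a convex combination of `(s + 1) * z` and `0`, and `f 0 = 0`.
  have hs1 : fLink lam c (s * z) ≤ s / (s + 1) * fLink lam c ((s + 1) * z) := by
    have h1 := hconv.2 (mem_Ici.2 (by positivity : (0 : ℝ) ≤ (s + 1) * z))
      (mem_Ici.2 (le_refl (0 : ℝ))) (by positivity : 0 ≤ s / (s + 1))
      (by positivity : 0 ≤ 1 / (s + 1)) (by rw [← add_div]; exact div_self (by positivity))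
    have h2 : s / (s + 1) * ((s + 1) * z) = s * z := by field_simp
    simpa [smul_eq_mul, fLink_zero, h2] using h1
  have h1 := hup z hz
  have h2 := hlow' z hz
  have h0 : 0 ≤ t₁ * |fLink lam c z| + t₂ * z + (t₃ + b) := by positivity
  have hss : s / (s + 1) ≤ 1 := by rw [div_le_one (by positivity)]; linarith
  have h3 : s / (s + 1) * fLink lam c ((s + 1) * z) ≤
      t₁ * |fLink lam c z| + t₂ * z + (t₃ + b) :=
    (mul_le_mul_of_nonneg_left h1 (by positivity)).trans (mul_le_of_le_one_left h0 hss)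
  have h4 : 0 ≤ t₁ * |fLink lam c z| := by positivity
  have h5 : 0 ≤ t₂ * z := by positivity
  have h6 : 0 ≤ B * s * z := by positivity
  rw [abs_le]
  constructor <;> nlinarith

/-- With `w = s * z`, the tangent at `w` evaluated at `0` and at `2 * w` gives `f w ≤ lam (w / (c +
w)) * w ≤ f (2 * w) - f w`. Both ends are controlled by the bound on dilations. -/
theorem abs_lam_mul_le (hl : IsRegularLink lam) (hc : 0 < c) (hd : FLinkDefined lam c)
    (hg : GrowthCondition (fLink lam c)) {s : ℝ} (hs : 0 < s) :
    ∃ A B D : ℝ, 0 ≤ A ∧ 0 ≤ B ∧ 0 ≤ D ∧ ∀ z, 0 ≤ z →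
      |lam (s * z / (c + s * z)) * z| ≤ A * |fLink lam c z| + B * z + D := by
  obtain ⟨A, B, D, hA, hB, hD, h⟩ := abs_fLink_mul_le hl hc hd hg hs
  obtain ⟨A', B', D', hA', hB', hD', h'⟩ := abs_fLink_mul_le hl hc hd hg (s := 2 * s) (by positivity)
  refine ⟨s⁻¹ * (A + A'), s⁻¹ * (B + B'), s⁻¹ * (D + D'), by positivity, by positivity,
    by positivity, fun z hz => ?_⟩
  rcases hz.eq_or_lt with rfl | hz'
  · simp only [mul_zero, abs_zero]
    positivity
  set w := s * z with hw
  have hw0 : 0 < w := by positivity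
  have h1 := tangent_le_fLink hl hc hd hw0 (z := 2 * w) (by positivity)
  have h2 := tangent_le_fLink hl hc hd hw0 le_rfl
  rw [fLink_zero] at h2
  have h3 := h z hz
  have h4 := h' z hz
  rw [mul_assoc, ← hw] at h4
  have h5 : |lam (w / (c + w)) * w| ≤ |fLink lam c w| + |fLink lam c (2 * w)| := by
    have := le_abs_self (fLink lam c (2 * w))
    have := neg_abs_le (fLink lam c w)
    have := abs_nonneg (fLink lam c (2 * w))
    rw [abs_le]
    constructor <;> linarith
  have h6 : lam (w / (c + w)) * z = s⁻¹ * (lam (w / (c + w)) * w) := by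
    rw [hw]; field_simp
  rw [h6, abs_mul, abs_of_pos (by positivity : 0 < s⁻¹)]
  calc s⁻¹ * |lam (w / (c + w)) * w|
      ≤ s⁻¹ * (A * |fLink lam c z| + B * z + D + (A' * |fLink lam c z| + B' * z + D')) := by
        gcongr; linarith
    _ = _ := by ring

end Link

/-! ### Finite divergence, uniqueness, and a quantitative form of strict convexity -/

section Divergence

variable {Z : Type*} [MeasurableSpace Z] {ρ : Measure Z} {f : ℝ → ℝ} {p p' q : Z → ℝ}

/-- `p` is dominated by `q` and has a finite `f`-divergence from it. -/
def HasFiniteDivergence (f : ℝ → ℝ) (ρ : Measure Z) (p q : Z → ℝ) : Prop :=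
  (∀ᵐ z ∂ρ, q z = 0 → p z = 0) ∧ Integrable (fun z => f (p z / q z) * q z) ρ

theorem HasFiniteDivergence.fDivergence_eq (h : HasFiniteDivergence f ρ p q) :
    fDivergence f ρ p q = ((∫ z, f (p z / q z) * q z ∂ρ : ℝ) : EReal) :=
  if_pos h

theorem hasFiniteDivergence_of_lt_top (h : fDivergence f ρ p q < ⊤) :
    HasFiniteDivergence f ρ p q := by
  by_contra hn
  have : fDivergence f ρ p q = ⊤ := if_neg hn
  simp [this] at h

theorem measurable_comp_of_continuousOn_Ici (hf : ContinuousOn f (Ici 0)) {r : Z → ℝ}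
    (hr : Measurable r) (hr0 : ∀ z, 0 ≤ r z) : Measurable fun z => f (r z) := by
  have h1 : Continuous fun x : ℝ => f (max x 0) :=
    hf.comp_continuous (by fun_prop) fun x => le_max_right x 0
  have h2 : (fun z => f (r z)) = (fun x : ℝ => f (max x 0)) ∘ r := by
    ext z; simp [max_eq_left (hr0 z)]
  rw [h2]
  exact h1.measurable.comp hr

theorem measurable_divergence_integrand (hf : ContinuousOn f (Ici 0)) (hp : Measurable p)
    (hp0 : ∀ z, 0 ≤ p z) (hq : Measurable q) (hq0 : ∀ z, 0 ≤ q z) :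
    Measurable fun z => f (p z / q z) * q z :=
  (measurable_comp_of_continuousOn_Ici hf (hp.div hq) fun z => div_nonneg (hp0 z) (hq0 z)).mul hq

theorem divergence_integrand_midpoint_le (hf : ConvexOn ℝ (Ici 0) f) {a b k : ℝ} (ha : 0 ≤ a)
    (hb : 0 ≤ b) (hk : 0 ≤ k) :
    f ((a + b) / 2 / k) * k ≤ (f (a / k) * k + f (b / k) * k) / 2 := by
  have h1 := hf.2 (mem_Ici.2 (div_nonneg ha hk)) (mem_Ici.2 (div_nonneg hb hk))
    (by norm_num : (0 : ℝ) ≤ 1 / 2) (by norm_num : (0 : ℝ) ≤ 1 / 2) (by norm_num)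
  have h2 : (1 / 2 : ℝ) • (a / k) + (1 / 2 : ℝ) • (b / k) = (a + b) / 2 / k := by
    simp only [smul_eq_mul]; ring
  rw [h2] at h1
  simp only [smul_eq_mul] at h1
  have := mul_le_mul_of_nonneg_right h1 hk
  linarith

/-- No domination is needed: for `k = 0` the integrand is `0` and the lower bound is `-(B * a) ≤ 0`.
-/
theorem affine_le_divergence_integrand {A B : ℝ} (hlow : ∀ z, 0 ≤ z → -(A + B * z) ≤ f z)
    (hB : 0 ≤ B) {a k : ℝ} (ha : 0 ≤ a) (hk : 0 ≤ k) : -(A * k + B * a) ≤ f (a / k) * k := by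
  rcases hk.eq_or_lt with rfl | hk'
  · simp; positivity
  · have := mul_le_mul_of_nonneg_right (hlow (a / k) (div_nonneg ha hk)) hk
    have h2 : a / k * k = a := by field_simp
    have h3 : -(A + B * (a / k)) * k = -(A * k + B * (a / k * k)) := by ring
    rw [h3, h2] at this
    exact this

/-- The integrand lies between the affine minorant and the average of the two given integrands, all
integrable. -/
theorem HasFiniteDivergence.midpoint (hc : ContinuousOn f (Ici 0)) (hf : ConvexOn ℝ (Ici 0) f)
    {A B : ℝ} (hB : 0 ≤ B) (hlow : ∀ z, 0 ≤ z → -(A + B * z) ≤ f z)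
    (hq : IsProbDensity ρ q) (hp : IsProbDensity ρ p) (hp' : IsProbDensity ρ p')
    (h : HasFiniteDivergence f ρ p q) (h' : HasFiniteDivergence f ρ p' q) :
    HasFiniteDivergence f ρ (fun z => (p z + p' z) / 2) q := by
  refine ⟨?_, ?_⟩
  · filter_upwards [h.1, h'.1] with z h1 h2 hz
    simp [h1 hz, h2 hz]
  · refine integrable_of_le_of_le (f := fun z => f ((p z + p' z) / 2 / q z) * q z)
      (g₁ := fun z => -(A * q z + B * ((p z + p' z) / 2)))
      (g₂ := fun z => (f (p z / q z) * q z + f (p' z / q z) * q z) / 2) ?_ ?_ ?_ ?_ ?_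
    · exact (measurable_divergence_integrand hc ((hp.measurable.add hp'.measurable).div_const 2)
        (fun z => by have := hp.nonneg z; have := hp'.nonneg z; simp only [Pi.add_apply]; positivity)
        hq.measurable hq.nonneg).aestronglyMeasurable
    · exact ae_of_all _ fun z => affine_le_divergence_integrand hlow hB
        (by have := hp.nonneg z; have := hp'.nonneg z; positivity) (hq.nonneg z)
    · exact ae_of_all _ fun z =>
        divergence_integrand_midpoint_le hf (hp.nonneg z) (hp'.nonneg z) (hq.nonneg z)
    · exact ((hq.integrable.const_mul A).add
        (((hp.integrable.add hp'.integrable).div_const 2).const_mul B)).neg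
    · exact (h.2.add h'.2).div_const 2

theorem integral_half_add_sub {u v w : Z → ℝ} (hu : Integrable u ρ) (hv : Integrable v ρ)
    (hw : Integrable w ρ) :
    ∫ z, ((u z + v z) / 2 - w z) ∂ρ = (∫ z, u z ∂ρ + ∫ z, v z ∂ρ) / 2 - ∫ z, w z ∂ρ := by
  have h := integral_sub ((hu.add hv).div_const 2) hw
  simp only [Pi.add_apply] at h
  rw [h, integral_div, integral_add hu hv]

/-- A projection with finite divergence is unique, for strictly convex `f`. -/
theorem IsFProjection.ae_eq (hc : ContinuousOn f (Ici 0)) (hf : StrictConvexOn ℝ (Ici 0) f)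
    {A B : ℝ} (hB : 0 ≤ B) (hlow : ∀ z, 0 ≤ z → -(A + B * z) ≤ f z)
    (hq : IsProbDensity ρ q) {C : Set (Z → ℝ)} (hC : ∀ p ∈ C, IsProbDensity ρ p)
    (hmid : ∀ p ∈ C, ∀ p' ∈ C, (fun z => (p z + p' z) / 2) ∈ C)
    (hfin : ∃ p ∈ C, fDivergence f ρ p q < ⊤)
    (h : IsFProjection f ρ q C p) (h' : IsFProjection f ρ q C p') : p =ᵐ[ρ] p' := by
  obtain ⟨p₀, hp₀, hlt⟩ := hfin
  have hF := hasFiniteDivergence_of_lt_top ((h.2 p₀ hp₀).trans_lt hlt)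
  have hF' := hasFiniteDivergence_of_lt_top ((h'.2 p₀ hp₀).trans_lt hlt)
  have hp := hC p h.1
  have hp' := hC p' h'.1
  have hM := hF.midpoint hc hf.convexOn hB hlow hq hp hp' hF'
  have h1 := h.2 _ (hmid p h.1 p' h'.1)
  have h2 := h'.2 _ (hmid p h.1 p' h'.1)
  rw [hF.fDivergence_eq, hM.fDivergence_eq, EReal.coe_le_coe_iff] at h1
  rw [hF'.fDivergence_eq, hM.fDivergence_eq, EReal.coe_le_coe_iff] at h2
  have hgi : Integrable (fun z => (f (p z / q z) * q z + f (p' z / q z) * q z) / 2 -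
      f ((p z + p' z) / 2 / q z) * q z) ρ := ((hF.2.add hF'.2).div_const 2).sub hM.2
  have hg0 : ∀ z, 0 ≤ (f (p z / q z) * q z + f (p' z / q z) * q z) / 2 -
      f ((p z + p' z) / 2 / q z) * q z := fun z =>
    sub_nonneg.2 (divergence_integrand_midpoint_le hf.convexOn (hp.nonneg z) (hp'.nonneg z)
      (hq.nonneg z))
  -- Neither projection has a larger divergence than the midpoint, so the nonnegative convexity gap
  -- has integral at most `0` and vanishes almost everywhere.
  have hint : ∫ z, ((f (p z / q z) * q z + f (p' z / q z) * q z) / 2 -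
      f ((p z + p' z) / 2 / q z) * q z) ∂ρ ≤ 0 := by
    refine (integral_half_add_sub hF.2 hF'.2 hM.2).le.trans ?_
    linarith
  have hzero := (integral_eq_zero_iff_of_nonneg (fun z => hg0 z) hgi).1
    (le_antisymm hint (integral_nonneg fun z => hg0 z))
  filter_upwards [hzero, hF.1, hF'.1] with z hz hd hd'
  by_cases hqz : q z = 0
  · rw [hd hqz, hd' hqz]
  have hqpos : 0 < q z := lt_of_le_of_ne (hq.nonneg z) (Ne.symm hqz)
  by_contra hne
  have hne' : p z / q z ≠ p' z / q z := fun he => hne (by field_simp at he; exact he)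
  have h3 := hf.2 (mem_Ici.2 (div_nonneg (hp.nonneg z) hqpos.le))
    (mem_Ici.2 (div_nonneg (hp'.nonneg z) hqpos.le)) hne'
    (by norm_num : (0 : ℝ) < 1 / 2) (by norm_num : (0 : ℝ) < 1 / 2) (by norm_num)
  have h4 : (1 / 2 : ℝ) • (p z / q z) + (1 / 2 : ℝ) • (p' z / q z) =
      (p z + p' z) / 2 / q z := by
    simp only [smul_eq_mul]; ring
  rw [h4] at h3
  simp only [smul_eq_mul] at h3
  have h5 := mul_lt_mul_of_pos_right h3 hqpos
  simp only [Pi.zero_apply] at hz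
  linarith

/-- For a superlinear strictly convex `f`, the distance of two points is controlled by the midpoint
convexity gap, up to a small multiple of the values of `f`. -/
theorem abs_sub_le_midpoint_gap (hc : ContinuousOn f (Ici 0)) (hf : StrictConvexOn ℝ (Ici 0) f)
    (hsup : ∀ N : ℝ, ∃ B : ℝ, 0 ≤ B ∧ ∀ z, 0 ≤ z → N * z - B ≤ f z) {A : ℝ} (hA : 0 ≤ A)
    (hfA : ∀ z, 0 ≤ z → 0 ≤ f z + A) {ε : ℝ} (hε : 0 < ε) :
    ∃ K : ℝ, 0 ≤ K ∧ ∀ a b, 0 ≤ a → 0 ≤ b →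
      |a - b| ≤ ε * (1 + (f a + A) + (f b + A)) + K * ((f a + f b) / 2 - f ((a + b) / 2)) := by
  -- Slope `2 / ε` gives `ε * f a ≥ 2 * a - ε * B`, which exceeds `a` once `a > ε * B`. The larger
  -- point then pays for the distance by itself.
  obtain ⟨B, hB, hsB⟩ := hsup (2 / ε)
  have hgap : ∀ a b, 0 ≤ a → 0 ≤ b → 0 ≤ (f a + f b) / 2 - f ((a + b) / 2) := fun a b ha hb => by
    have := divergence_integrand_midpoint_le hf.convexOn ha hb zero_le_one
    simp only [div_one, mul_one] at this
    linarith
  have hbig : ∀ a b, 0 ≤ b → b ≤ a → ε * B < a → |a - b| ≤ ε * (1 + (f a + A) + (f b + A)) := by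
    intro a b hb hba ha
    have ha0 : 0 ≤ a := hb.trans hba
    have h1 := mul_le_mul_of_nonneg_left (hsB a ha0) hε.le
    have h2 : ε * (2 / ε * a - B) = 2 * a - ε * B := by field_simp
    have h3 := mul_nonneg hε.le (hfA b hb)
    have h4 := mul_nonneg hε.le hA
    rw [abs_of_nonneg (by linarith)]
    nlinarith
  -- What remains is compact: both points at most `ε * B` and at least `ε` apart. There the gap is
  -- continuous and positive, hence bounded away from `0`, while the distance is at most `ε * B`.
  -- Closer pairs are absorbed by the summand `ε * 1`.
  set S : Set (ℝ × ℝ) := (Icc 0 (ε * B) ×ˢ Icc 0 (ε * B)) ∩ {x | ε ≤ |x.1 - x.2|} with hS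
  have hScomp : IsCompact S :=
    (isCompact_Icc.prod isCompact_Icc).inter_right
      (isClosed_le continuous_const (by fun_prop))
  have hScont : ContinuousOn (fun x : ℝ × ℝ => (f x.1 + f x.2) / 2 - f ((x.1 + x.2) / 2)) S := by
    refine ContinuousOn.sub (ContinuousOn.div_const (ContinuousOn.add ?_ ?_) _) ?_
    · exact hc.comp (by fun_prop) fun x hx => hx.1.1.1
    · exact hc.comp (by fun_prop) fun x hx => hx.1.2.1
    · refine hc.comp (by fun_prop) fun x hx => ?_
      have h1 := hx.1.1.1
      have h2 := hx.1.2.1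
      simp only [mem_Ici]
      positivity
  obtain ⟨K, hK, hKS⟩ : ∃ K : ℝ, 0 ≤ K ∧ ∀ x ∈ S,
      ε * B ≤ K * ((f x.1 + f x.2) / 2 - f ((x.1 + x.2) / 2)) := by
    rcases S.eq_empty_or_nonempty with he | hne
    · exact ⟨0, le_rfl, fun x hx => by simp [he] at hx⟩
    obtain ⟨x₀, hx₀, hmin⟩ := hScomp.exists_isMinOn hne hScont
    have hne' : x₀.1 ≠ x₀.2 := fun he => by
      have := hx₀.2
      simp only [mem_ofPred_eq, he, sub_self, abs_zero] at this
      linarith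
    have hpos : 0 < (f x₀.1 + f x₀.2) / 2 - f ((x₀.1 + x₀.2) / 2) := by
      have h3 := hf.2 (mem_Ici.2 hx₀.1.1.1) (mem_Ici.2 hx₀.1.2.1) hne'
        (by norm_num : (0 : ℝ) < 1 / 2) (by norm_num : (0 : ℝ) < 1 / 2) (by norm_num)
      have h4 : (1 / 2 : ℝ) • x₀.1 + (1 / 2 : ℝ) • x₀.2 = (x₀.1 + x₀.2) / 2 := by
        simp only [smul_eq_mul]; ring
      rw [h4] at h3
      simp only [smul_eq_mul] at h3
      linarith
    refine ⟨ε * B / ((f x₀.1 + f x₀.2) / 2 - f ((x₀.1 + x₀.2) / 2)), by positivity,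
      fun x hx => ?_⟩
    rw [div_mul_eq_mul_div, le_div_iff₀ hpos]
    exact mul_le_mul_of_nonneg_left (hmin hx) (by positivity)
  refine ⟨K, hK, fun a b ha hb => ?_⟩
  have hg := mul_nonneg hK (hgap a b ha hb)
  have hn : 0 ≤ ε * (1 + (f a + A) + (f b + A)) := by
    have := hfA a ha
    have := hfA b hb
    positivity
  by_cases hR : ε * B < max a b
  · rcases le_total a b with hab | hab
    · rw [max_eq_right hab] at hR
      have := hbig b a ha hab hR
      rw [abs_sub_comm]
      linarith
    · rw [max_eq_left hab] at hR
      have := hbig a b hb hab hR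
      linarith
  · rw [not_lt, max_le_iff] at hR
    by_cases hd : ε ≤ |a - b|
    · have h1 := hKS (a, b) ⟨⟨⟨ha, hR.1⟩, ⟨hb, hR.2⟩⟩, hd⟩
      have h2 : |a - b| ≤ ε * B := by rw [abs_le]; constructor <;> linarith [hR.1, hR.2]
      simp only at h1
      linarith
    · have h1 : ε * 1 ≤ ε * (1 + (f a + A) + (f b + A)) := by
        have := hfA a ha
        have := hfA b hb
        gcongr; linarith
      linarith

end Divergence

/-! ### Existence of projections -/

section Existence

variable {Z : Type*} [MeasurableSpace Z] {ρ : Measure Z} {f : ℝ → ℝ} {q : Z → ℝ}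

/-- A sequence of probability densities that is Cauchy in variational distance converges to a
probability density. -/
theorem exists_isProbDensity_tendsto {P : ℕ → Z → ℝ} (hP : ∀ n, IsProbDensity ρ (P n))
    (hcau : ∀ ε : ℝ, 0 < ε → ∃ N, ∀ m ≥ N, ∀ n ≥ N, ∫ z, |P m z - P n z| ∂ρ < ε) :
    ∃ p, IsProbDensity ρ p ∧ Tendsto (fun n => ∫ z, |P n z - p z| ∂ρ) atTop (𝓝 0) := by
  let L : ℕ → Lp ℝ 1 ρ := fun n => (hP n).integrable.toL1 (P n)
  have hdist : ∀ m n, dist (L m) (L n) = ∫ z, |P m z - P n z| ∂ρ := fun m n => by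
    rw [L1.dist_eq_integral_dist]
    refine integral_congr_ae ?_
    filter_upwards [(hP m).integrable.coeFn_toL1, (hP n).integrable.coeFn_toL1] with z h1 h2
    simp only [L, h1, h2, Real.dist_eq]
  have hL : CauchySeq L := Metric.cauchySeq_iff.2 fun ε hε => by
    obtain ⟨N, hN⟩ := hcau ε hε
    exact ⟨N, fun m hm n hn => by rw [hdist]; exact hN m hm n hn⟩
  obtain ⟨g, hg⟩ := cauchySeq_tendsto_of_complete hL
  have hgi : Integrable g ρ := L1.integrable_coeFn g
  -- A probability density must be nonnegative everywhere. Taking positive parts is a contraction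
  -- that fixes each `P n`, so the convergence survives.
  let p : Z → ℝ := fun z => max (g z) 0
  have hpm : Measurable p := (Lp.stronglyMeasurable g).measurable.max measurable_const
  have hpi : Integrable p ρ := hgi.pos_part
  have hlim : Tendsto (fun n => ∫ z, |P n z - p z| ∂ρ) atTop (𝓝 0) := by
    refine squeeze_zero (fun n => integral_nonneg fun z => abs_nonneg _) (fun n => ?_)
      (tendsto_iff_dist_tendsto_zero.1 hg)
    rw [L1.dist_eq_integral_dist]
    refine integral_mono_ae ((hP n).integrable.sub hpi).abs ?_ ?_
    · simpa only [Real.dist_eq, Pi.sub_apply] using ((L1.integrable_coeFn (L n)).sub hgi).abs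
    · filter_upwards [(hP n).integrable.coeFn_toL1] with z h1
      simp only [L, h1, Real.dist_eq, p]
      have := abs_max_sub_max_le_abs (P n z) (g z) 0
      rwa [max_eq_left ((hP n).nonneg z)] at this
  refine ⟨p, ⟨hpm, fun z => le_max_right _ _, hpi, ?_⟩, hlim⟩
  have h1 : Tendsto (fun n => ∫ z, P n z ∂ρ) atTop (𝓝 (∫ z, p z ∂ρ)) := by
    refine tendsto_iff_norm_sub_tendsto_zero.2 (squeeze_zero (fun n => norm_nonneg _) (fun n => ?_)
      hlim)
    rw [← integral_sub (hP n).integrable hpi]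
    exact norm_integral_le_integral_norm _
  simp only [(hP _).integral_eq_one] at h1
  exact tendsto_nhds_unique h1 tendsto_const_nhds

/-- The divergence is lower semicontinuous with respect to the variational distance. -/
theorem HasFiniteDivergence.of_tendsto (hc : ContinuousOn f (Ici 0)) {A : ℝ}
    (hfA : ∀ z, 0 ≤ z → 0 ≤ f z + A) (hq : IsProbDensity ρ q) {P : ℕ → Z → ℝ} {p : Z → ℝ}
    (hP : ∀ n, IsProbDensity ρ (P n)) (hp : IsProbDensity ρ p)
    (hF : ∀ n, HasFiniteDivergence f ρ (P n) q)
    (hlim : Tendsto (fun n => ∫ z, |P n z - p z| ∂ρ) atTop (𝓝 0)) {m : ℝ}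
    (hm : Tendsto (fun n => ∫ z, f (P n z / q z) * q z ∂ρ) atTop (𝓝 m)) :
    HasFiniteDivergence f ρ p q ∧ ∫ z, f (p z / q z) * q z ∂ρ ≤ m := by
  have hmeas : TendstoInMeasure ρ P atTop p := by
    refine tendstoInMeasure_of_tendsto_eLpNorm one_ne_zero
      (fun n => (hP n).measurable.aestronglyMeasurable) hp.measurable.aestronglyMeasurable ?_
    have h1 : ∀ n, eLpNorm (P n - p) 1 ρ = ENNReal.ofReal (∫ z, |P n z - p z| ∂ρ) := fun n => by
      have hi : Integrable (fun z => |P n z - p z|) ρ :=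
        ((hP n).integrable.sub hp.integrable).abs
      rw [eLpNorm_one_eq_lintegral_enorm,
        ofReal_integral_eq_lintegral_ofReal hi (ae_of_all _ fun z => abs_nonneg _)]
      refine lintegral_congr fun z => ?_
      rw [← ofReal_norm, Real.norm_eq_abs, Pi.sub_apply]
    simp only [h1]
    simpa using ENNReal.tendsto_ofReal hlim
  obtain ⟨ns, hns, hae⟩ := hmeas.exists_seq_tendsto_ae
  have hdom : ∀ᵐ z ∂ρ, q z = 0 → p z = 0 := by
    filter_upwards [hae, ae_all_iff.2 fun n => (hF n).1] with z h1 h2 hz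
    simp only [h2 _ hz] at h1
    exact tendsto_nhds_unique h1 tendsto_const_nhds
  -- Adding `A * q` makes the integrand nonnegative, as Fatou's lemma requires, and shifts the
  -- integral by exactly `A`.
  let G : (Z → ℝ) → Z → ℝ := fun p z => f (p z / q z) * q z + A * q z
  have hG0 : ∀ p : Z → ℝ, (∀ z, 0 ≤ p z) → ∀ z, 0 ≤ G p z := fun p h z => by
    have := mul_nonneg (hfA _ (div_nonneg (h z) (hq.nonneg z))) (hq.nonneg z)
    simp only [G]
    linarith
  have hGm : ∀ p, IsProbDensity ρ p → Measurable (G p) := fun p h =>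
    (measurable_divergence_integrand hc h.measurable h.nonneg hq.measurable hq.nonneg).add
      (hq.measurable.const_mul A)
  have hGi : ∀ n, Integrable (G (P n)) ρ := fun n => (hF n).2.add (hq.integrable.const_mul A)
  have hGint : ∀ p, HasFiniteDivergence f ρ p q →
      ∫ z, G p z ∂ρ = ∫ z, f (p z / q z) * q z ∂ρ + A := fun p h => by
    simp only [G]
    rw [integral_add h.2 (hq.integrable.const_mul A), integral_const_mul, hq.integral_eq_one,
      mul_one]
  have hGlim : ∀ᵐ z ∂ρ, Tendsto (fun k => G (P (ns k)) z) atTop (𝓝 (G p z)) := by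
    filter_upwards [hae] with z hz
    have h1 : Tendsto (fun k => P (ns k) z / q z) atTop (𝓝[Ici 0] (p z / q z)) :=
      tendsto_nhdsWithin_iff.2 ⟨hz.div_const _, Eventually.of_forall fun k =>
        div_nonneg ((hP _).nonneg z) (hq.nonneg z)⟩
    exact ((((hc _ (div_nonneg (hp.nonneg z) (hq.nonneg z))).tendsto.comp h1).mul_const _).add_const
      _)
  have hfatou : ∫⁻ z, ENNReal.ofReal (G p z) ∂ρ ≤ ENNReal.ofReal (m + A) := by
    have h1 : ∫⁻ z, ENNReal.ofReal (G p z) ∂ρ =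
        ∫⁻ z, liminf (fun k => ENNReal.ofReal (G (P (ns k)) z)) atTop ∂ρ := by
      refine lintegral_congr_ae ?_
      filter_upwards [hGlim] with z hz
      exact (ENNReal.tendsto_ofReal hz).liminf_eq.symm
    have h2 : Tendsto (fun k => ∫⁻ z, ENNReal.ofReal (G (P (ns k)) z) ∂ρ) atTop
        (𝓝 (ENNReal.ofReal (m + A))) := by
      have h3 : ∀ k, ∫⁻ z, ENNReal.ofReal (G (P (ns k)) z) ∂ρ =
          ENNReal.ofReal (∫ z, f (P (ns k) z / q z) * q z ∂ρ + A) := fun k => by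
        rw [← hGint _ (hF _), ofReal_integral_eq_lintegral_ofReal (hGi _)
          (ae_of_all _ (hG0 _ (hP _).nonneg))]
      simp only [h3]
      exact ENNReal.tendsto_ofReal ((hm.comp hns.tendsto_atTop).add_const A)
    rw [h1, ← h2.liminf_eq]
    exact lintegral_liminf_le fun k => (hGm _ (hP _)).ennreal_ofReal
  have hGpi : Integrable (G p) ρ := by
    refine ⟨(hGm p hp).aestronglyMeasurable, ?_⟩
    rw [hasFiniteIntegral_iff_ofReal (ae_of_all _ (hG0 p hp.nonneg))]
    exact hfatou.trans_lt ENNReal.ofReal_lt_top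
  have hFp : HasFiniteDivergence f ρ p q := by
    refine ⟨hdom, ?_⟩
    have := hGpi.sub (hq.integrable.const_mul A)
    refine this.congr (ae_of_all _ fun z => ?_)
    simp [G]
  refine ⟨hFp, ?_⟩
  have hmA : 0 ≤ m + A := by
    refine ge_of_tendsto' (hm.add_const A) fun n => ?_
    rw [← hGint _ (hF n)]
    exact integral_nonneg (hG0 _ (hP n).nonneg)
  rw [← ofReal_integral_eq_lintegral_ofReal hGpi (ae_of_all _ (hG0 p hp.nonneg)),
    ENNReal.ofReal_le_ofReal_iff hmA, hGint p hFp] at hfatou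
  linarith

/-- Existence of projections for superlinear `f`. A minimizing sequence is Cauchy in variational
distance by strict convexity. -/
theorem exists_isFProjection (hc : ContinuousOn f (Ici 0)) (hf : StrictConvexOn ℝ (Ici 0) f)
    (hsup : ∀ N : ℝ, ∃ B : ℝ, 0 ≤ B ∧ ∀ z, 0 ≤ z → N * z - B ≤ f z)
    (hq : IsProbDensity ρ q) {C : Set (Z → ℝ)} (hC : ∀ p ∈ C, IsProbDensity ρ p)
    (hmid : ∀ p ∈ C, ∀ p' ∈ C, (fun z => (p z + p' z) / 2) ∈ C)
    (hfin : ∃ p ∈ C, fDivergence f ρ p q < ⊤) (hclosed : SublevelsClosedInVariation f ρ q C) :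
    ∃ p, IsFProjection f ρ q C p := by
  obtain ⟨A, hA, hA'⟩ := hsup 0
  have hfA : ∀ z, 0 ≤ z → 0 ≤ f z + A := fun z hz => by linarith [hA' z hz]
  have hlow : ∀ z, 0 ≤ z → -(A + 0 * z) ≤ f z := fun z hz => by linarith [hA' z hz]
  let D : (Z → ℝ) → ℝ := fun p => ∫ z, f (p z / q z) * q z ∂ρ
  let S : Set ℝ := D '' {p | p ∈ C ∧ HasFiniteDivergence f ρ p q}
  have hSne : S.Nonempty := by
    obtain ⟨p, hp, hlt⟩ := hfin
    exact ⟨_, p, ⟨hp, hasFiniteDivergence_of_lt_top hlt⟩, rfl⟩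
  have hDA : ∀ p, IsProbDensity ρ p → HasFiniteDivergence f ρ p q →
      ∫ z, (f (p z / q z) * q z + A * q z) ∂ρ = D p + A := fun p _ hF => by
    rw [integral_add hF.2 (hq.integrable.const_mul A), integral_const_mul, hq.integral_eq_one,
      mul_one]
  have hfAq : ∀ p, IsProbDensity ρ p → ∀ z, 0 ≤ f (p z / q z) * q z + A * q z := fun p hp z => by
    have := mul_nonneg (hfA _ (div_nonneg (hp.nonneg z) (hq.nonneg z))) (hq.nonneg z)
    linarith
  have hSb : BddBelow S := by
    refine ⟨-A, ?_⟩
    rintro _ ⟨p, ⟨hp, hF⟩, rfl⟩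
    have : 0 ≤ ∫ z, (f (p z / q z) * q z + A * q z) ∂ρ := integral_nonneg (hfAq p (hC p hp))
    rw [hDA p (hC p hp) hF] at this
    linarith
  have hseq : ∀ n : ℕ, ∃ p, (p ∈ C ∧ HasFiniteDivergence f ρ p q) ∧
      D p < sInf S + 1 / ((n : ℝ) + 1) := fun n => by
    obtain ⟨_, ⟨p, hp, rfl⟩, hlt⟩ := exists_lt_of_csInf_lt hSne
      (lt_add_of_pos_right (sInf S) (by positivity : (0 : ℝ) < 1 / ((n : ℝ) + 1)))
    exact ⟨p, hp, hlt⟩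
  choose P hPC hPlt using hseq
  have hP : ∀ n, IsProbDensity ρ (P n) := fun n => hC _ (hPC n).1
  have hF : ∀ n, HasFiniteDivergence f ρ (P n) q := fun n => (hPC n).2
  have hPge : ∀ n, sInf S ≤ D (P n) := fun n => csInf_le hSb ⟨P n, hPC n, rfl⟩
  have hone : ∀ n : ℕ, 1 / ((n : ℝ) + 1) ≤ 1 := fun n => by
    rw [div_le_one (by positivity)]
    linarith [n.cast_nonneg (α := ℝ)]
  have hlimD : Tendsto (fun n => D (P n)) atTop (𝓝 (sInf S)) := by
    refine tendsto_of_tendsto_of_tendsto_of_le_of_le tendsto_const_nhds ?_ hPge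
      fun n => (hPlt n).le
    simpa using tendsto_one_div_add_atTop_nhds_zero_nat.const_add (sInf S)
  -- The pointwise gap inequality at `P m / q` and `P n / q` is multiplied by `q` and integrated.
  -- The midpoint of `P m` and `P n` lies in `C`, so its divergence is at least `sInf S`.
  have hbound : ∀ ε : ℝ, 0 < ε → ∃ K : ℝ, 0 ≤ K ∧ ∀ m n, ∫ z, |P m z - P n z| ∂ρ ≤
      ε * (1 + (D (P m) + A) + (D (P n) + A)) + K * ((D (P m) + D (P n)) / 2 - sInf S) := by
    intro ε hε
    obtain ⟨K, hK, hKle⟩ := abs_sub_le_midpoint_gap hc hf hsup hA hfA hε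
    refine ⟨K, hK, fun m n => ?_⟩
    have hM := (hF m).midpoint hc hf.convexOn le_rfl hlow hq (hP m) (hP n) (hF n)
    have hMge : sInf S ≤ ∫ z, f ((P m z + P n z) / 2 / q z) * q z ∂ρ :=
      csInf_le hSb ⟨_, ⟨hmid _ (hPC m).1 _ (hPC n).1, hM⟩, rfl⟩
    have hi1 : ∀ k, Integrable (fun z => f (P k z / q z) * q z + A * q z) ρ := fun k =>
      (hF k).2.add (hq.integrable.const_mul A)
    have hi2 : Integrable (fun z => (f (P m z / q z) * q z + f (P n z / q z) * q z) / 2 -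
      f ((P m z + P n z) / 2 / q z) * q z) ρ := (((hF m).2.add (hF n).2).div_const 2).sub hM.2
    have hi4 : Integrable (fun z => q z + (f (P m z / q z) * q z + A * q z)) ρ :=
      hq.integrable.add (hi1 m)
    have hi3 : Integrable (fun z => q z + (f (P m z / q z) * q z + A * q z) +
      (f (P n z / q z) * q z + A * q z)) ρ := hi4.add (hi1 n)
    have hle : ∫ z, |P m z - P n z| ∂ρ ≤ ∫ z, (ε * (q z + (f (P m z / q z) * q z + A * q z) +
        (f (P n z / q z) * q z + A * q z)) +
        K * ((f (P m z / q z) * q z + f (P n z / q z) * q z) / 2 -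
          f ((P m z + P n z) / 2 / q z) * q z)) ∂ρ := by
      refine integral_mono_ae ((hP m).integrable.sub (hP n).integrable).abs
        ((hi3.const_mul ε).add (hi2.const_mul K)) ?_
      filter_upwards [(hF m).1, (hF n).1] with z hm hn
      by_cases hqz : q z = 0
      · simp [hqz, hm hqz, hn hqz]
      have hqpos : 0 < q z := lt_of_le_of_ne (hq.nonneg z) (Ne.symm hqz)
      have h1 := mul_le_mul_of_nonneg_right (hKle (P m z / q z) (P n z / q z)
        (div_nonneg ((hP m).nonneg z) hqpos.le) (div_nonneg ((hP n).nonneg z) hqpos.le)) hqpos.le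
      have h2 : |P m z / q z - P n z / q z| * q z = |P m z - P n z| := by
        rw [← sub_div, abs_div, abs_of_pos hqpos]
        field_simp
      have h3 : (P m z / q z + P n z / q z) / 2 = (P m z + P n z) / 2 / q z := by ring
      rw [h2, h3] at h1
      refine h1.trans (le_of_eq ?_)
      ring
    refine hle.trans ?_
    rw [integral_add (hi3.const_mul ε) (hi2.const_mul K), integral_const_mul, integral_const_mul,
      integral_half_add_sub (hF m).2 (hF n).2 hM.2, integral_add hi4 (hi1 n),
      integral_add hq.integrable (hi1 m), hDA _ (hP m) (hF m), hDA _ (hP n) (hF n),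
      hq.integral_eq_one]
    gcongr
  have hcau : ∀ ε : ℝ, 0 < ε → ∃ N, ∀ m ≥ N, ∀ n ≥ N, ∫ z, |P m z - P n z| ∂ρ < ε := by
    intro ε hε
    -- Each `D (P n)` is at most `sInf S + 1`, so `E` bounds the factor of `ε` in `hbound`. Using `ε
    -- / (2 * E)` there leaves `ε / 2` for the gap term, which is small for large indices.
    set E : ℝ := 1 + (sInf S + 1 + A) + (sInf S + 1 + A) with hE
    have hE0 : 0 < E := by
      have h1 : 0 ≤ ∫ z, (f (P 0 z / q z) * q z + A * q z) ∂ρ := integral_nonneg (hfAq _ (hP 0))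
      rw [hDA _ (hP 0) (hF 0)] at h1
      have := hPlt 0
      have := hone 0
      linarith
    obtain ⟨K, hK, hKle⟩ := hbound (ε / (2 * E)) (by positivity)
    obtain ⟨N, hN⟩ := exists_nat_one_div_lt (show 0 < ε / (2 * (K + 1)) by positivity)
    refine ⟨N, fun m hm n hn => ?_⟩
    have hsmall : ∀ k ≥ N, D (P k) - sInf S < ε / (2 * (K + 1)) := fun k hk => by
      have h1 := hPlt k
      have h2 : 1 / ((k : ℝ) + 1) ≤ 1 / ((N : ℝ) + 1) := by gcongr
      linarith
    have h1 := hsmall m hm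
    have h2 := hsmall n hn
    have h3 : ε / (2 * E) * (1 + (D (P m) + A) + (D (P n) + A)) ≤ ε / (2 * E) * E := by
      have := hPlt m
      have := hPlt n
      have := hone m
      have := hone n
      gcongr
      linarith
    have h4 : ε / (2 * E) * E = ε / 2 := by field_simp
    have h5 : K * ((D (P m) + D (P n)) / 2 - sInf S) ≤ K * (ε / (2 * (K + 1))) := by
      gcongr
      linarith
    have h6 : K * (ε / (2 * (K + 1))) < ε / 2 := by
      rw [mul_div_assoc', div_lt_div_iff₀ (by positivity) (by positivity)]
      nlinarith
    linarith [hKle m n]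
  obtain ⟨p, hp, hlim⟩ := exists_isProbDensity_tendsto hP hcau
  have hpC : p ∈ C := hclosed (sInf S + 1) P p hp (fun n => ⟨(hPC n).1, by
    rw [(hF n).fDivergence_eq, EReal.coe_le_coe_iff]
    exact (hPlt n).le.trans (by linarith [hone n])⟩) hlim
  obtain ⟨hFp, hle⟩ := HasFiniteDivergence.of_tendsto hc hfA hq hP hp hF hlim hlimD
  refine ⟨p, hpC, fun p' hp' => ?_⟩
  by_cases htop : fDivergence f ρ p' q < ⊤
  · have hF' := hasFiniteDivergence_of_lt_top htop
    rw [hFp.fDivergence_eq, hF'.fDivergence_eq, EReal.coe_le_coe_iff]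
    exact hle.trans (csInf_le hSb ⟨p', ⟨hp', hF'⟩, rfl⟩)
  · rw [not_lt_top_iff.1 htop]
    exact le_top

end Existence

/-! ### Bounded functionals on `L¹` and separation -/

section Duality

variable {Z : Type*} [MeasurableSpace Z] {P : Measure Z}

/-- The inclusion of `L²` into `L¹` for a probability measure. -/
noncomputable def lpTwoToLpOne (P : Measure Z) [IsProbabilityMeasure P] : Lp ℝ 2 P →L[ℝ] Lp ℝ 1 P :=
  LinearMap.mkContinuous
    { toFun := fun f => ((Lp.memLp f).mono_exponent one_le_two).toLp f
      map_add' := fun f g => by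
        rw [← MemLp.toLp_add]
        exact MemLp.toLp_congr _ _ (Lp.coeFn_add f g)
      map_smul' := fun r f => by
        rw [RingHom.id_apply, ← MemLp.toLp_const_smul]
        exact MemLp.toLp_congr _ _ (Lp.coeFn_smul r f) }
    1 fun f => by
      simp only [LinearMap.coe_mk, AddHom.coe_mk, one_mul]
      rw [Lp.norm_toLp, Lp.norm_def]
      exact ENNReal.toReal_mono (Lp.eLpNorm_ne_top f)
        (eLpNorm_le_eLpNorm_of_exponent_le one_le_two (Lp.aestronglyMeasurable f))

theorem coeFn_lpTwoToLpOne [IsProbabilityMeasure P] (f : Lp ℝ 2 P) : lpTwoToLpOne P f =ᵐ[P] f :=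
  MemLp.coeFn_toLp ((Lp.memLp f).mono_exponent one_le_two)

/-- Continuous functionals on `L¹` of a probability measure are represented by bounded functions. -/
theorem exists_bounded_representation [IsProbabilityMeasure P] (ℓ : Lp ℝ 1 P →L[ℝ] ℝ) :
    ∃ g : Z → ℝ, Measurable g ∧ (∀ z, |g z| ≤ ‖ℓ‖) ∧
      ∀ (f : Z → ℝ) (hf : Integrable f P), ℓ (hf.toL1 f) = ∫ z, f z * g z ∂P := by
  -- Riesz representation in `L²` supplies the candidate. Testing on indicators bounds it by the
  -- norm of `ℓ`, and density extends the formula to `L¹`.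
  let G : Lp ℝ 2 P := (InnerProductSpace.toDual ℝ (Lp ℝ 2 P)).symm (ℓ.comp (lpTwoToLpOne P))
  have hG : ∀ f : Lp ℝ 2 P, ℓ (lpTwoToLpOne P f) = ∫ z, f z * G z ∂P := fun f => by
    have h1 : inner ℝ G f = ℓ (lpTwoToLpOne P f) := by
      simp [G, InnerProductSpace.toDual_symm_apply]
    rw [← h1, L2.inner_def]
    rfl
  have hGi : Integrable G P := (Lp.memLp G).integrable one_le_two
  have hset : ∀ s, MeasurableSet s → ∀ hi : Integrable (s.indicator fun _ => (1 : ℝ)) P,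
      ℓ (hi.toL1 _) = ∫ z in s, G z ∂P := fun s hs hi => by
    have hm : MemLp (s.indicator fun _ => (1 : ℝ)) 2 P := (memLp_const 1).indicator hs
    have h1 : lpTwoToLpOne P (hm.toLp _) = hi.toL1 _ := by
      refine Lp.ext ?_
      filter_upwards [coeFn_lpTwoToLpOne (hm.toLp _), hm.coeFn_toLp, hi.coeFn_toL1] with z a b c
      rw [a, b, c]
    rw [← h1, hG, ← integral_indicator hs]
    refine integral_congr_ae ?_
    filter_upwards [hm.coeFn_toLp] with z hz
    rw [hz]
    by_cases hzs : z ∈ s <;> simp [hzs]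
  have hbound : ∀ s, MeasurableSet s → |∫ z in s, G z ∂P| ≤ ∫ z in s, ‖ℓ‖ ∂P := fun s hs => by
    have hi : Integrable (s.indicator fun _ => (1 : ℝ)) P := (integrable_const 1).indicator hs
    rw [← hset s hs hi, setIntegral_const, smul_eq_mul, mul_comm, ← Real.norm_eq_abs]
    refine (ℓ.le_opNorm _).trans ?_
    gcongr
    rw [L1.norm_of_fun_eq_integral_norm]
    have : ∀ z, ‖s.indicator (fun _ => (1 : ℝ)) z‖ = s.indicator (fun _ => (1 : ℝ)) z := fun z => by
      by_cases hzs : z ∈ s <;> simp [hzs]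
    simp only [this]
    rw [integral_indicator hs]
    simp
  have hle1 : G ≤ᵐ[P] fun _ => ‖ℓ‖ := by
    refine ae_le_of_forall_setIntegral_le hGi (integrable_const _) fun s hs _ => ?_
    exact (le_abs_self _).trans (hbound s hs)
  have hle2 : (fun _ => -‖ℓ‖) ≤ᵐ[P] G := by
    refine ae_le_of_forall_setIntegral_le (integrable_const _) hGi fun s hs _ => ?_
    rw [integral_neg]
    exact (neg_le_neg (hbound s hs)).trans (neg_abs_le _)
  -- The truncation changes `G` only on a null set and makes the bound hold everywhere.
  let g : Z → ℝ := fun z => max (min (G z) ‖ℓ‖) (-‖ℓ‖)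
  have hgG : g =ᵐ[P] G := by
    filter_upwards [hle1, hle2] with z h1 h2
    simp only [g]
    rw [min_eq_left h1, max_eq_left h2]
  have hgm : Measurable g :=
    ((Lp.stronglyMeasurable G).measurable.min measurable_const).max measurable_const
  have hgb : ∀ z, |g z| ≤ ‖ℓ‖ := fun z => by
    rw [abs_le]
    exact ⟨le_max_right _ _, max_le (min_le_right _ _) (by linarith [norm_nonneg ℓ])⟩
  have hmul : ∀ f : Z → ℝ, Integrable f P → Integrable (fun z => f z * g z) P := fun f hf =>
    hf.mul_bdd hgm.aestronglyMeasurable (ae_of_all _ hgb)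
  refine ⟨g, hgm, hgb, fun f hf => ?_⟩
  refine Integrable.induction (fun f : Z → ℝ => ∀ hf : Integrable f P,
    ℓ (hf.toL1 f) = ∫ z, f z * g z ∂P) ?_ ?_ ?_ ?_ hf hf
  · intro k s hs _ hf
    have hi : Integrable (s.indicator fun _ => (1 : ℝ)) P := (integrable_const 1).indicator hs
    have h1 : hf.toL1 _ = k • hi.toL1 _ := by
      rw [← Integrable.toL1_smul]
      refine (Integrable.toL1_eq_toL1_iff _ _ _ _).2 (ae_of_all _ fun z => ?_)
      by_cases hzs : z ∈ s <;> simp [hzs]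
    rw [h1, map_smul, hset s hs hi, ← integral_indicator hs, smul_eq_mul, ← integral_const_mul]
    refine integral_congr_ae ?_
    filter_upwards [hgG] with z hz
    rw [hz]
    by_cases hzs : z ∈ s <;> simp [hzs]
  · intro f f' _ hf hf' h h' _
    rw [Integrable.toL1_add f f' hf hf', map_add, h hf, h' hf', ← integral_add (hmul f hf) (hmul f' hf')]
    simp only [Pi.add_apply, add_mul]
  · have hc2 : ∀ u : Lp ℝ 1 P, ‖∫ z, u z * g z ∂P‖ ≤ ‖ℓ‖ * ‖u‖ := fun u => by
      rw [L1.norm_eq_integral_norm, ← integral_const_mul]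
      refine norm_integral_le_of_norm_le ((L1.integrable_coeFn u).norm.const_mul _)
        (ae_of_all _ fun z => ?_)
      rw [norm_mul, mul_comm]
      exact mul_le_mul_of_nonneg_right (hgb z) (norm_nonneg _)
    let Λ : Lp ℝ 1 P →L[ℝ] ℝ := LinearMap.mkContinuous
      { toFun := fun u => ∫ z, u z * g z ∂P
        map_add' := fun u v => by
          rw [← integral_add (hmul _ (L1.integrable_coeFn u)) (hmul _ (L1.integrable_coeFn v))]
          refine integral_congr_ae ?_
          filter_upwards [Lp.coeFn_add u v] with z hz
          rw [hz, Pi.add_apply, add_mul]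
        map_smul' := fun r u => by
          rw [RingHom.id_apply, smul_eq_mul, ← integral_const_mul]
          refine integral_congr_ae ?_
          filter_upwards [Lp.coeFn_smul r u] with z hz
          rw [hz, Pi.smul_apply, smul_eq_mul, mul_assoc] } ‖ℓ‖ hc2
    have heq : {u : Lp ℝ 1 P | ∀ hf : Integrable u P, ℓ (hf.toL1 u) = ∫ z, u z * g z ∂P} =
        {u | ℓ u = Λ u} := by
      ext u
      simp only [mem_ofPred_eq, Integrable.toL1_coeFn]
      exact ⟨fun h => h (L1.integrable_coeFn u), fun h _ => h⟩
    change IsClosed {u : Lp ℝ 1 P | ∀ hf : Integrable u P, ℓ (hf.toL1 u) = ∫ z, u z * g z ∂P}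
    rw [heq]
    exact isClosed_eq ℓ.continuous Λ.continuous
  · intro f f' hff' hf h hf'
    rw [← (Integrable.toL1_eq_toL1_iff _ _ hf hf').2 hff', h hf]
    refine integral_congr_ae ?_
    filter_upwards [hff'] with z hz
    rw [hz]

/-- A function outside the `L¹`-closure of a space of functions is separated from it by a bounded
function. -/
theorem exists_bounded_of_not_memL1Closure [IsProbabilityMeasure P] {S : Submodule ℝ (Z → ℝ)}
    (hS : ∀ w ∈ S, Integrable w P) {F : Z → ℝ} (hF : Integrable F P)
    (hn : ¬ MemL1Closure P S F) :
    ∃ g : Z → ℝ, Measurable g ∧ (∃ B, ∀ z, |g z| ≤ B) ∧ (∀ w ∈ S, ∫ z, w z * g z ∂P = 0) ∧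
      ∫ z, F z * g z ∂P ≠ 0 := by
  let W : Submodule ℝ (Lp ℝ 1 P) :=
    { carrier := {u | ∃ w ∈ S, u =ᵐ[P] w}
      add_mem' := by
        rintro u v ⟨w, hw, huw⟩ ⟨w', hw', hvw⟩
        refine ⟨w + w', S.add_mem hw hw', ?_⟩
        filter_upwards [Lp.coeFn_add u v, huw, hvw] with z h1 h2 h3
        rw [h1, Pi.add_apply, Pi.add_apply, h2, h3]
      zero_mem' := ⟨0, S.zero_mem, Lp.coeFn_zero _ _ _⟩
      smul_mem' := by
        rintro r u ⟨w, hw, huw⟩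
        refine ⟨r • w, S.smul_mem r hw, ?_⟩
        filter_upwards [Lp.coeFn_smul r u, huw] with z h1 h2
        rw [h1, Pi.smul_apply, Pi.smul_apply, h2] }
  have hnot : hF.toL1 F ∉ closure (W : Set (Lp ℝ 1 P)) := by
    intro hmem
    refine hn ⟨hF, fun ε hε => ?_⟩
    obtain ⟨u, ⟨w, hw, huw⟩, hd⟩ := Metric.mem_closure_iff.1 hmem ε hε
    refine ⟨w, hw, hS w hw, ?_⟩
    rw [L1.dist_eq_integral_dist] at hd
    refine lt_of_eq_of_lt (integral_congr_ae ?_) hd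
    filter_upwards [hF.coeFn_toL1, huw] with z h1 h2
    rw [h1, h2, Real.dist_eq]
  obtain ⟨ℓ, s, hs, hsF⟩ := geometric_hahn_banach_closed_point
    (W.convex.closure) isClosed_closure hnot
  -- A functional bounded above by `s` on a subspace vanishes there: otherwise some multiple of `u`
  -- has value `s + 1`.
  have hzero : ∀ u ∈ W, ℓ u = 0 := fun u hu => by
    by_contra hne
    have h1 := hs (((s + 1) / ℓ u) • u) (subset_closure (W.smul_mem _ hu))
    rw [map_smul, smul_eq_mul, div_mul_cancel₀ _ hne] at h1
    linarith
  have hs0 : 0 < s := by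
    have := hs 0 (subset_closure W.zero_mem)
    rwa [map_zero] at this
  obtain ⟨g, hgm, hgb, hg⟩ := exists_bounded_representation ℓ
  refine ⟨g, hgm, ⟨_, hgb⟩, fun w hw => ?_, ?_⟩
  · rw [← hg w (hS w hw)]
    exact hzero _ ⟨w, hw, (hS w hw).coeFn_toL1⟩
  · rw [← hg F hF]
    exact (hs0.trans hsF).ne'

end Duality

/-! ### Directional derivatives of the divergence -/

section FirstOrder

variable {Z : Type*} [MeasurableSpace Z] {ρ : Measure Z} {lam : ℝ → ℝ} {c : ℝ} {p q : Z → ℝ}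

theorem measurable_lam_comp (hl : IsRegularLink lam) (hc : 0 < c) {r : Z → ℝ} (hr : Measurable r)
    (hr0 : ∀ z, 0 ≤ r z) : Measurable fun z => lam (r z / (c + r z)) := by
  -- Nothing is known about `lam` at `0`, so the case `r z = 0` is split off as a constant piece.
  have h1 : Measurable ((Ioi (0 : ℝ)).piecewise (fun v => lam (v / (c + v))) fun _ => lam 0) :=
    ContinuousOn.measurable_piecewise
      (fun v hv => (hl.continuousAt_comp hc hv).continuousWithinAt) continuousOn_const
      measurableSet_Ioi
  convert h1.comp hr using 1
  ext z
  rcases (hr0 z).eq_or_lt with h | h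
  · simp [← h]
  · simp [h]

theorem integrable_div_mul (hq : IsProbDensity ρ q) (hp : IsProbDensity ρ p) :
    Integrable (fun z => p z / q z * q z) ρ := by
  refine hp.integrable.mono' ((hp.measurable.div hq.measurable).mul hq.measurable).aestronglyMeasurable
    (ae_of_all _ fun z => ?_)
  rw [Real.norm_of_nonneg (mul_nonneg (div_nonneg (hp.nonneg z) (hq.nonneg z)) (hq.nonneg z))]
  rcases (hq.nonneg z).eq_or_lt with h | h
  · simpa [← h] using hp.nonneg z
  · rw [div_mul_cancel₀ _ h.ne']

theorem HasFiniteDivergence.integrable_of_abs_le {f : ℝ → ℝ} (h : HasFiniteDivergence f ρ p q)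
    (hq : IsProbDensity ρ q) (hp : IsProbDensity ρ p) {G : Z → ℝ} (hG : Measurable G) {A B D : ℝ}
    (hle : ∀ z, |G z| ≤ A * |f (p z / q z)| + B * (p z / q z) + D) :
    Integrable (fun z => G z * q z) ρ := by
  have h1 : Integrable (fun z => A * |f (p z / q z) * q z| + B * (p z / q z * q z) + D * q z) ρ :=
    ((h.2.abs.const_mul A).add ((integrable_div_mul hq hp).const_mul B)).add
      (hq.integrable.const_mul D)
  refine h1.mono' (hG.mul hq.measurable).aestronglyMeasurable (ae_of_all _ fun z => ?_)
  rw [Real.norm_eq_abs, abs_mul, abs_mul, abs_of_nonneg (hq.nonneg z)]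
  have := mul_le_mul_of_nonneg_right (hle z) (hq.nonneg z)
  linarith

/-- Finiteness of the divergence is preserved by bounded changes of the density. -/
theorem HasFiniteDivergence.mul_bounded (hl : IsRegularLink lam) (hc : 0 < c)
    (hd : FLinkDefined lam c) (hg : GrowthCondition (fLink lam c)) (hq : IsProbDensity ρ q)
    (hp : IsProbDensity ρ p) (h : HasFiniteDivergence (fLink lam c) ρ p q) {s : Z → ℝ}
    (hs : Measurable s) (hs1 : ∀ z, 1 / 2 ≤ s z) (hs2 : ∀ z, s z ≤ 3 / 2) :
    HasFiniteDivergence (fLink lam c) ρ (fun z => p z * s z) q := by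
  obtain ⟨A, B, hA, hB, hlow⟩ := exists_affine_le_fLink hl hc hd
  obtain ⟨A₁, B₁, D₁, hA₁, hB₁, hD₁, h₁⟩ := abs_fLink_mul_le hl hc hd hg (s := 1 / 2) (by norm_num)
  obtain ⟨A₂, B₂, D₂, hA₂, hB₂, hD₂, h₂⟩ := abs_fLink_mul_le hl hc hd hg (s := 3 / 2) (by norm_num)
  have hconv := (strictConvexOn_fLink hl hc hd).convexOn
  refine ⟨by filter_upwards [h.1] with z hz hqz; simp [hz hqz], ?_⟩
  have hr0 : ∀ z, 0 ≤ p z / q z := fun z => div_nonneg (hp.nonneg z) (hq.nonneg z)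
  have hs0 : ∀ z, 0 ≤ s z := fun z => by linarith [hs1 z]
  have hmeas : Measurable fun z => fLink lam c (p z * s z / q z) :=
    measurable_comp_of_continuousOn_Ici (continuousOn_fLink hl hc hd)
      ((hp.measurable.mul hs).div hq.measurable)
      fun z => div_nonneg (mul_nonneg (hp.nonneg z) (hs0 z)) (hq.nonneg z)
  refine h.integrable_of_abs_le hq hp hmeas (A := A₁ + A₂) (B := B₁ + B₂ + 3 / 2 * B)
    (D := D₁ + D₂ + A) fun z => ?_
  set r := p z / q z with hr
  have hrz : 0 ≤ r := hr0 z
  have hrs : p z * s z / q z = r * s z := by rw [hr]; ring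
  rw [hrs]
  have h3 := h₁ r hrz
  have h4 := h₂ r hrz
  have h5 := hlow (r * s z) (mul_nonneg hrz (hs0 z))
  -- The point `r * s z` lies between `r / 2` and `3 * r / 2`: convexity bounds `f` above by the
  -- larger endpoint value, and the affine minorant bounds it below.
  have h6 : r * s z ≤ 3 / 2 * r := by nlinarith [hs2 z]
  have h7 := mul_le_mul_of_nonneg_left h6 hB
  have h8 : fLink lam c (r * s z) ≤ max (fLink lam c (1 / 2 * r)) (fLink lam c (3 / 2 * r)) := by
    refine hconv.le_max_of_mem_Icc (mem_Ici.2 (by positivity)) (mem_Ici.2 (by positivity))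
      ⟨by nlinarith [hs1 z], h6⟩
  have h9 : max (fLink lam c (1 / 2 * r)) (fLink lam c (3 / 2 * r)) ≤
      |fLink lam c (1 / 2 * r)| + |fLink lam c (3 / 2 * r)| :=
    max_le (by linarith [le_abs_self (fLink lam c (1 / 2 * r)), abs_nonneg (fLink lam c (3 / 2 * r))])
      (by linarith [le_abs_self (fLink lam c (3 / 2 * r)), abs_nonneg (fLink lam c (1 / 2 * r))])
  have h10 := abs_nonneg (fLink lam c (1 / 2 * r))
  have h11 := abs_nonneg (fLink lam c (3 / 2 * r))
  have h12 : 0 ≤ B * r := mul_nonneg hB hrz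
  rw [abs_le]
  constructor <;> nlinarith

theorem abs_lam_comp_mul_le (hl : IsRegularLink lam) (hc : 0 < c) {r s : ℝ} (hr : 0 ≤ r)
    (hs1 : 1 / 2 ≤ s) (hs2 : s ≤ 3 / 2) :
    |lam (r * s / (c + r * s)) * r| ≤
      |lam (1 / 2 * r / (c + 1 / 2 * r)) * r| + |lam (3 / 2 * r / (c + 3 / 2 * r)) * r| := by
  rcases hr.eq_or_lt with rfl | hr'
  · simp
  have hmono := (hl.strictMonoOn_comp hc).monotoneOn
  have h1 := hmono (mem_Ioi.2 (by positivity : 0 < 1 / 2 * r))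
    (mem_Ioi.2 (by positivity : 0 < r * s)) (by nlinarith)
  have h2 := hmono (mem_Ioi.2 (by positivity : 0 < r * s))
    (mem_Ioi.2 (by positivity : 0 < 3 / 2 * r)) (by nlinarith)
  simp only at h1 h2
  rw [abs_mul, abs_mul, abs_mul, ← add_mul]
  refine mul_le_mul_of_nonneg_right ?_ (abs_nonneg r)
  rw [abs_le]
  have h3 := neg_abs_le (lam (1 / 2 * r / (c + 1 / 2 * r)))
  have h4 := le_abs_self (lam (3 / 2 * r / (c + 3 / 2 * r)))
  have h5 := abs_nonneg (lam (1 / 2 * r / (c + 1 / 2 * r)))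
  have h6 := abs_nonneg (lam (3 / 2 * r / (c + 3 / 2 * r)))
  constructor <;> linarith

/-- The case `s = 1` is integrability of the derivative itself; `s = 1 / 2` and `s = 3 / 2` give the
dominating function for perturbations by factors in between. -/
theorem HasFiniteDivergence.integrable_lam (hl : IsRegularLink lam) (hc : 0 < c)
    (hd : FLinkDefined lam c) (hg : GrowthCondition (fLink lam c)) (hq : IsProbDensity ρ q)
    (hp : IsProbDensity ρ p) (h : HasFiniteDivergence (fLink lam c) ρ p q) {s : ℝ} (hs : 0 < s) :
    Integrable (fun z => lam (s * (p z / q z) / (c + s * (p z / q z))) * (p z / q z) * q z) ρ := by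
  obtain ⟨A, B, D, -, -, -, hle⟩ := abs_lam_mul_le hl hc hd hg hs
  have hr0 : ∀ z, 0 ≤ p z / q z := fun z => div_nonneg (hp.nonneg z) (hq.nonneg z)
  have hrm : Measurable fun z => p z / q z := hp.measurable.div hq.measurable
  exact h.integrable_of_abs_le hq hp
    ((measurable_lam_comp hl hc (hrm.const_mul s) fun z => mul_nonneg hs.le (hr0 z)).mul hrm)
    fun z => hle _ (hr0 z)

/-- The directional derivative of the divergence at a minimum is nonnegative. -/
theorem HasFiniteDivergence.integral_lam_mul_nonneg (hl : IsRegularLink lam) (hc : 0 < c)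
    (hd : FLinkDefined lam c) (hgr : GrowthCondition (fLink lam c)) (hq : IsProbDensity ρ q)
    (hp : IsProbDensity ρ p) (h : HasFiniteDivergence (fLink lam c) ρ p q) {g : Z → ℝ}
    (hg : Measurable g) (hgb : ∀ z, |g z| ≤ 1 / 2)
    (hmin : ∀ t, 0 < t → t ≤ 1 → ∫ z, fLink lam c (p z / q z) * q z ∂ρ ≤
      ∫ z, fLink lam c (p z * (1 + t * g z) / q z) * q z ∂ρ) :
    0 ≤ ∫ z, lam (p z / q z / (c + p z / q z)) * (p z / q z) * q z * g z ∂ρ := by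
  let r : Z → ℝ := fun z => p z / q z
  have hr0 : ∀ z, 0 ≤ r z := fun z => div_nonneg (hp.nonneg z) (hq.nonneg z)
  have hrm : Measurable r := hp.measurable.div hq.measurable
  -- Where `r z > 0`, this is the derivative in `t` of the integrand at `p * (1 + t * g)`; where `r
  -- z = 0`, it is `0`.
  let J : ℝ → Z → ℝ := fun t z =>
    lam (r z * (1 + t * g z) / (c + r z * (1 + t * g z))) * r z * q z * g z
  have hs1 : ∀ t z, 0 ≤ t → t ≤ 1 → 1 / 2 ≤ 1 + t * g z := fun t z h0 h1 => by
    have := neg_le_of_abs_le (hgb z)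
    nlinarith
  have hs2 : ∀ t z, 0 ≤ t → t ≤ 1 → 1 + t * g z ≤ 3 / 2 := fun t z h0 h1 => by
    have := le_of_abs_le (hgb z)
    nlinarith
  have hsm : ∀ t : ℝ, Measurable fun z => 1 + t * g z := fun t => (hg.const_mul t).const_add 1
  let bound : Z → ℝ := fun z => |lam (1 / 2 * r z / (c + 1 / 2 * r z)) * r z * q z| +
    |lam (3 / 2 * r z / (c + 3 / 2 * r z)) * r z * q z|
  have hbi : Integrable bound ρ :=
    (h.integrable_lam hl hc hd hgr hq hp (by norm_num : (0 : ℝ) < 1 / 2)).abs.add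
      (h.integrable_lam hl hc hd hgr hq hp (by norm_num : (0 : ℝ) < 3 / 2)).abs
  have hJm : ∀ t, 0 ≤ t → t ≤ 1 → AEStronglyMeasurable (J t) ρ := fun t h0 h1 =>
    ((((measurable_lam_comp hl hc (hrm.mul (hsm t)) fun z =>
      mul_nonneg (hr0 z) (by linarith [hs1 t z h0 h1])).mul hrm).mul hq.measurable).mul
        hg).aestronglyMeasurable
  have hJb : ∀ t, 0 ≤ t → t ≤ 1 → ∀ z, ‖J t z‖ ≤ bound z := fun t h0 h1 z => by
    have h2 := abs_lam_comp_mul_le hl hc (hr0 z) (hs1 t z h0 h1) (hs2 t z h0 h1)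
    have h3 := mul_le_mul_of_nonneg_right h2 (hq.nonneg z)
    have h4 : bound z = (|lam (1 / 2 * r z / (c + 1 / 2 * r z)) * r z| +
        |lam (3 / 2 * r z / (c + 3 / 2 * r z)) * r z|) * q z := by
      simp only [bound]
      rw [abs_mul _ (q z), abs_mul _ (q z), abs_of_nonneg (hq.nonneg z), add_mul]
    have h5 : ‖J t z‖ = |lam (r z * (1 + t * g z) / (c + r z * (1 + t * g z))) * r z| * q z *
        |g z| := by
      simp only [J]
      rw [Real.norm_eq_abs, abs_mul _ (g z), abs_mul _ (q z), abs_of_nonneg (hq.nonneg z)]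
    rw [h4, h5]
    refine le_trans ?_ h3
    exact mul_le_of_le_one_right (mul_nonneg (abs_nonneg _) (hq.nonneg z)) (by linarith [hgb z])
  have hpos : ∀ t, 0 < t → t ≤ 1 → 0 ≤ ∫ z, J t z ∂ρ := fun t h0 h1 => by
    have hF := h.mul_bounded hl hc hd hgr hq hp (hsm t) (hs1 t · h0.le h1) (hs2 t · h0.le h1)
    have hJi : Integrable (J t) ρ := hbi.mono' (hJm t h0.le h1) (ae_of_all _ (hJb t h0.le h1))
    have h2 := hmin t h0 h1
    -- The tangent at the perturbed point, evaluated at the unperturbed one, bounds the increment by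
    -- `t * J t`. Thus `∫ J t ≥ 0` for each `t > 0`, and only the limit of `J t` as `t → 0` is
    -- needed, not that of difference quotients.
    have h3 : ∫ z, fLink lam c (p z * (1 + t * g z) / q z) * q z ∂ρ -
        ∫ z, fLink lam c (p z / q z) * q z ∂ρ ≤ ∫ z, t * J t z ∂ρ := by
      rw [← integral_sub hF.2 h.2]
      refine integral_mono (hF.2.sub h.2) (hJi.const_mul t) fun z => ?_
      have hrs : p z * (1 + t * g z) / q z = r z * (1 + t * g z) := by simp only [r]; ring
      simp only [J]
      rw [hrs]
      change fLink lam c (r z * (1 + t * g z)) * q z - fLink lam c (r z) * q z ≤ _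
      rcases (hr0 z).eq_or_lt with hz | hz
      · simp [← hz]
      have h4 := tangent_le_fLink hl hc hd
        (mul_pos hz (by linarith [hs1 t z h0.le h1] : 0 < 1 + t * g z)) hz.le
      have h5 := mul_le_mul_of_nonneg_right h4 (hq.nonneg z)
      nlinarith
    rw [integral_const_mul] at h3
    exact nonneg_of_mul_nonneg_right (by linarith) h0
  have hlim : Tendsto (fun n : ℕ => ∫ z, J (1 / ((n : ℝ) + 1)) z ∂ρ) atTop (𝓝 (∫ z, J 0 z ∂ρ)) := by
    have ht0 : ∀ n : ℕ, 0 < 1 / ((n : ℝ) + 1) := fun n => by positivity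
    have ht1 : ∀ n : ℕ, 1 / ((n : ℝ) + 1) ≤ 1 := fun n => by
      rw [div_le_one (by positivity)]
      linarith [n.cast_nonneg (α := ℝ)]
    refine tendsto_integral_of_dominated_convergence bound (fun n => hJm _ (ht0 n).le (ht1 n)) hbi
      (fun n => ae_of_all _ (hJb _ (ht0 n).le (ht1 n))) (ae_of_all _ fun z => ?_)
    have h0 : J 0 z = lam (r z / (c + r z)) * r z * q z * g z := by simp [J]
    rw [h0]
    rcases (hr0 z).eq_or_lt with hz | hz
    · simp [J, ← hz]
    have h1 : Tendsto (fun n : ℕ => r z * (1 + 1 / ((n : ℝ) + 1) * g z)) atTop (𝓝 (r z)) := by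
      have := ((tendsto_one_div_add_atTop_nhds_zero_nat (𝕜 := ℝ)).mul_const (g z)).const_add 1
      simpa using this.const_mul (r z)
    exact ((((hl.continuousAt_comp hc hz).tendsto.comp h1).mul_const _).mul_const _).mul_const _
  have h0 : ∀ z, J 0 z = lam (p z / q z / (c + p z / q z)) * (p z / q z) * q z * g z := fun z => by
    simp [J, r]
  simp only [h0] at hlim
  refine ge_of_tendsto' hlim fun n => hpos _ (by positivity) ?_
  rw [div_le_one (by positivity)]
  linarith [n.cast_nonneg (α := ℝ)]

end FirstOrder

/-! ### Marginal densities -/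

section Marginals

theorem margY_eq_margX_swap {𝓧 𝓨 : Type*} [MeasurableSpace 𝓧] {ν : Measure 𝓧} (p : 𝓧 × 𝓨 → ℝ) :
    margY ν p = margX ν (p ∘ Prod.swap) := rfl

variable {𝓧 𝓨 : Type*} [MeasurableSpace 𝓧] [MeasurableSpace 𝓨]
  {ν : Measure 𝓧} {μ : Measure 𝓨} [SigmaFinite μ] {p p' : 𝓧 × 𝓨 → ℝ}

theorem integrable_margX (hp : Integrable p (ν.prod μ)) : Integrable (margX μ p) ν :=
  hp.integral_prod_left

variable [SigmaFinite ν]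

theorem integrable_margY (hp : Integrable p (ν.prod μ)) : Integrable (margY ν p) μ :=
  hp.integral_prod_right

theorem margX_add_ae (hp : Integrable p (ν.prod μ)) (hp' : Integrable p' (ν.prod μ)) (a b : ℝ) :
    margX μ (fun z => a * p z + b * p' z) =ᵐ[ν] fun x => a * margX μ p x + b * margX μ p' x := by
  filter_upwards [hp.prod_right_ae, hp'.prod_right_ae] with x h1 h2
  simp only [margX]
  rw [integral_add (h1.const_mul a) (h2.const_mul b), integral_const_mul, integral_const_mul]

theorem integral_abs_margX_sub_le (hp : Integrable p (ν.prod μ)) (hp' : Integrable p' (ν.prod μ)) :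
    ∫ x, |margX μ p x - margX μ p' x| ∂ν ≤ ∫ z, |p z - p' z| ∂(ν.prod μ) := by
  have hi : Integrable (fun z => |p z - p' z|) (ν.prod μ) := (hp.sub hp').abs
  rw [integral_prod _ hi]
  refine integral_mono_ae ((integrable_margX hp).sub (integrable_margX hp')).abs
    hi.integral_prod_left ?_
  filter_upwards [hp.prod_right_ae, hp'.prod_right_ae] with x h1 h2
  simp only [margX]
  rw [← integral_sub h1 h2]
  exact abs_integral_le_integral_abs

theorem integral_abs_margY_sub_le (hp : Integrable p (ν.prod μ)) (hp' : Integrable p' (ν.prod μ)) :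
    ∫ y, |margY ν p y - margY ν p' y| ∂μ ≤ ∫ z, |p z - p' z| ∂(ν.prod μ) := by
  rw [← integral_prod_swap]
  exact integral_abs_margX_sub_le hp.swap hp'.swap

theorem setIntegral_margX (hp : Integrable p (ν.prod μ)) {A : Set 𝓧} (hA : MeasurableSet A) :
    ∫ x in A, margX μ p x ∂ν = ∫ z, A.indicator (fun _ => (1 : ℝ)) z.1 * p z ∂(ν.prod μ) := by
  have hi : Integrable (fun z : 𝓧 × 𝓨 => A.indicator (fun _ => (1 : ℝ)) z.1 * p z) (ν.prod μ) := by
    refine hp.bdd_mul (c := 1)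
      ((measurable_const.indicator hA).comp measurable_fst).aestronglyMeasurable
      (ae_of_all _ fun z => ?_)
    by_cases hz : z.1 ∈ A <;> simp [hz]
  rw [integral_prod _ hi, ← integral_indicator hA]
  refine integral_congr_ae (ae_of_all _ fun x => ?_)
  simp only [integral_const_mul]
  by_cases hx : x ∈ A <;> simp [hx, margX]

/-- A function of `X` is integrable against the marginal density iff it is integrable against the
joint density. -/
theorem integrable_mul_margX_iff (hpm : Measurable p) (hp0 : ∀ z, 0 ≤ p z)
    (hp : Integrable p (ν.prod μ)) {u : 𝓧 → ℝ} (hu : Measurable u) :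
    Integrable (fun x => u x * margX μ p x) ν ↔
      Integrable (fun z => u z.1 * p z) (ν.prod μ) := by
  have hm : AEStronglyMeasurable (fun z : 𝓧 × 𝓨 => u z.1 * p z) (ν.prod μ) :=
    ((hu.comp measurable_fst).mul hpm).aestronglyMeasurable
  have h1 : ∀ x, ∫ y, ‖u x * p (x, y)‖ ∂μ = ‖u x * margX μ p x‖ := fun x => by
    have h2 : ∀ y, ‖u x * p (x, y)‖ = ‖u x‖ * p (x, y) := fun y => by
      rw [norm_mul, Real.norm_of_nonneg (hp0 _)]
    simp only [h2, integral_const_mul]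
    rw [norm_mul, margX, Real.norm_of_nonneg (integral_nonneg fun y => hp0 _)]
  rw [integrable_prod_iff hm]
  simp only [h1]
  rw [integrable_norm_iff (f := fun x => u x * margX μ p x)
    (hu.aestronglyMeasurable.mul (integrable_margX hp).aestronglyMeasurable)]
  refine ⟨fun h => ⟨?_, h⟩, fun h => h.2⟩
  filter_upwards [hp.prod_right_ae] with x hx
  exact hx.const_mul _

theorem integrable_mul_margY_iff (hpm : Measurable p) (hp0 : ∀ z, 0 ≤ p z)
    (hp : Integrable p (ν.prod μ)) {u : 𝓨 → ℝ} (hu : Measurable u) :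
    Integrable (fun y => u y * margY ν p y) μ ↔
      Integrable (fun z => u z.2 * p z) (ν.prod μ) := by
  rw [margY_eq_margX_swap, integrable_mul_margX_iff (hpm.comp measurable_swap)
    (fun z => hp0 _) hp.swap hu, ← integrable_swap_iff]
  rfl

theorem integral_mul_margY {u : 𝓨 → ℝ} (hi : Integrable (fun z => u z.2 * p z) (ν.prod μ)) :
    ∫ y, u y * margY ν p y ∂μ = ∫ z, u z.2 * p z ∂(ν.prod μ) := by
  rw [integral_prod_symm _ hi]
  simp only [integral_const_mul, margY]

theorem ae_eq_of_forall_integral_abs_sub_le {Z : Type*} [MeasurableSpace Z] {ρ : Measure Z}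
    {a k : Z → ℝ} (ha : Integrable a ρ) (hk : Integrable k ρ) {d : ℕ → ℝ}
    (hd : Tendsto d atTop (𝓝 0)) (hle : ∀ n, ∫ z, |k z - a z| ∂ρ ≤ d n) : a =ᵐ[ρ] k := by
  have h0 : ∫ z, |k z - a z| ∂ρ ≤ 0 := ge_of_tendsto' hd hle
  have hi : Integrable (fun z => |k z - a z|) ρ := (hk.sub ha).abs
  have := (integral_eq_zero_iff_of_nonneg (fun z => abs_nonneg (k z - a z)) hi).1
    (le_antisymm h0 (integral_nonneg fun z => abs_nonneg _))
  filter_upwards [this] with z hz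
  simp only [Pi.zero_apply, abs_eq_zero] at hz
  linarith

end Marginals

/-! ### The constraint set: convexity, closedness, admissible perturbations -/

section Constraints

variable {𝓧 𝓨 : Type*} [MeasurableSpace 𝓧] [MeasurableSpace 𝓨]
  {ν : Measure 𝓧} {μ : Measure 𝓨}
  {h : 𝓧 × 𝓨 → Fin 2 → ℝ} {𝓤 : Set (𝓨 → ℝ)} {p p' : 𝓧 × 𝓨 → ℝ}

theorem isProbDensity_condDensity (hh : IsFullDataDensity ν μ h) {m : Fin 2}
    (hm : 0 < probM ν μ h m) : IsProbDensity (ν.prod μ) (condDensity ν μ h m) where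
  measurable := (hh.measurable m).div_const _
  nonneg z := div_nonneg (hh.nonneg z m) hm.le
  integrable := (hh.integrable m).div_const _
  integral_eq_one := by
    simp only [condDensity]
    rw [integral_div]
    exact div_self hm.ne'

theorem probM_zero (hh : IsFullDataDensity ν μ h) : probM ν μ h 0 = 1 - probM ν μ h 1 := by
  have := hh.integral_eq_one
  rw [Fin.sum_univ_two] at this
  simp only [probM]
  linarith

variable [SigmaFinite ν] [SigmaFinite μ]

theorem integrable_mul_density (hh : IsFullDataDensity ν μ h) {u : 𝓨 → ℝ}
    (hu : u ∈ L1Density μ (densityY ν h)) (m : Fin 2) :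
    Integrable (fun z => u z.2 * h z m) (ν.prod μ) := by
  have h1 := (integrable_mul_margY_iff (p := fun z => ∑ m, h z m) (ν := ν) (μ := μ)
    (Finset.measurable_fun_sum _ fun m _ => hh.measurable m)
    (fun z => Finset.sum_nonneg fun m _ => hh.nonneg z m)
    (integrable_finsetSum _ fun m _ => hh.integrable m) hu.1).1 hu.2
  refine h1.mono ((hu.1.comp measurable_snd).mul (hh.measurable m)).aestronglyMeasurable
    (ae_of_all _ fun z => ?_)
  rw [norm_mul, norm_mul, Real.norm_of_nonneg (hh.nonneg z m),
    Real.norm_of_nonneg (Finset.sum_nonneg fun m _ => hh.nonneg z m)]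
  gcongr
  exact Finset.single_le_sum (f := fun m => h z m) (fun m _ => hh.nonneg z m) (Finset.mem_univ m)

theorem integrable_mul_condDensity (hh : IsFullDataDensity ν μ h) {u : 𝓨 → ℝ}
    (hu : u ∈ L1Density μ (densityY ν h)) (m : Fin 2) :
    Integrable (fun z => u z.2 * condDensity ν μ h m z) (ν.prod μ) := by
  simp only [condDensity, ← mul_div_assoc]
  exact (integrable_mul_density hh hu m).div_const _

/-- The constraints in terms of integrals against the joint density. -/
theorem mem_constraintSet_iff (hh : IsFullDataDensity ν μ h)
    (hU : 𝓤 ⊆ L1Density μ (densityY ν h)) :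
    p ∈ constraintSet ν μ h 𝓤 ↔ IsProbDensity (ν.prod μ) p ∧
      (margX μ p =ᵐ[ν] margX μ (condDensity ν μ h 1)) ∧
      ∀ u ∈ 𝓤, Integrable (fun z => u z.2 * p z) (ν.prod μ) ∧
        ∫ z, u z.2 * p z ∂(ν.prod μ) = ∫ z, u z.2 * condDensity ν μ h 1 z ∂(ν.prod μ) := by
  refine and_congr_right fun hp => and_congr_right fun _ => forall₂_congr fun u hu => ?_
  rw [integrable_mul_margY_iff hp.measurable hp.nonneg hp.integrable (hU hu).1]
  refine and_congr_right fun hi => ?_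
  rw [integral_mul_margY hi, integral_mul_margY (integrable_mul_condDensity hh (hU hu) 1)]

theorem midpoint_mem_constraintSet (hh : IsFullDataDensity ν μ h)
    (hU : 𝓤 ⊆ L1Density μ (densityY ν h)) (hp : p ∈ constraintSet ν μ h 𝓤)
    (hp' : p' ∈ constraintSet ν μ h 𝓤) :
    (fun z => (p z + p' z) / 2) ∈ constraintSet ν μ h 𝓤 := by
  rw [mem_constraintSet_iff hh hU] at hp hp' ⊢
  obtain ⟨hd, hX, hY⟩ := hp
  obtain ⟨hd', hX', hY'⟩ := hp'
  refine ⟨⟨(hd.measurable.add hd'.measurable).div_const 2, fun z => ?_,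
    (hd.integrable.add hd'.integrable).div_const 2, ?_⟩, ?_, fun u hu => ?_⟩
  · have := hd.nonneg z
    have := hd'.nonneg z
    positivity
  · rw [integral_div, integral_add hd.integrable hd'.integrable, hd.integral_eq_one,
      hd'.integral_eq_one]
    norm_num
  · have h1 : (fun z => (p z + p' z) / 2) = fun z => 1 / 2 * p z + 1 / 2 * p' z := by
      ext z; ring
    rw [h1]
    filter_upwards [margX_add_ae hd.integrable hd'.integrable (1 / 2) (1 / 2), hX, hX'] with x a b c
    rw [a, b, c]
    ring
  · obtain ⟨hi, he⟩ := hY u hu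
    obtain ⟨hi', he'⟩ := hY' u hu
    have h1 : (fun z : 𝓧 × 𝓨 => u z.2 * ((p z + p' z) / 2)) =
        fun z => (u z.2 * p z + u z.2 * p' z) / 2 := by
      ext z; ring
    rw [h1]
    refine ⟨(hi.add hi').div_const 2, ?_⟩
    rw [integral_div, integral_add hi hi', he, he']
    ring

theorem margX_ae_eq_of_tendsto {P : ℕ → 𝓧 × 𝓨 → ℝ} {k : 𝓧 → ℝ}
    (hP : ∀ n, Integrable (P n) (ν.prod μ)) (hp : Integrable p (ν.prod μ))
    (hk : ∀ n, margX μ (P n) =ᵐ[ν] k)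
    (hlim : Tendsto (fun n => ∫ z, |P n z - p z| ∂(ν.prod μ)) atTop (𝓝 0)) :
    margX μ p =ᵐ[ν] k := by
  refine ae_eq_of_forall_integral_abs_sub_le (integrable_margX hp)
    ((integrable_margX (hP 0)).congr (hk 0)) hlim fun n => ?_
  refine le_trans (le_of_eq (integral_congr_ae ?_)) (integral_abs_margX_sub_le (hP n) hp)
  filter_upwards [hk n] with x hx
  rw [hx]

theorem margY_ae_eq_of_tendsto {P : ℕ → 𝓧 × 𝓨 → ℝ} {k : 𝓨 → ℝ}
    (hP : ∀ n, Integrable (P n) (ν.prod μ)) (hp : Integrable p (ν.prod μ))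
    (hk : ∀ n, margY ν (P n) =ᵐ[μ] k)
    (hlim : Tendsto (fun n => ∫ z, |P n z - p z| ∂(ν.prod μ)) atTop (𝓝 0)) :
    margY ν p =ᵐ[μ] k := by
  refine ae_eq_of_forall_integral_abs_sub_le (integrable_margY hp)
    ((integrable_margY (hP 0)).congr (hk 0)) hlim fun n => ?_
  refine le_trans (le_of_eq (integral_congr_ae ?_)) (integral_abs_margY_sub_le (hP n) hp)
  filter_upwards [hk n] with x hx
  rw [hx]

/-- For bounded auxiliary functions the constraint set is closed in variational distance. -/
theorem mem_constraintSet_of_tendsto_of_bounded (hh : IsFullDataDensity ν μ h)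
    (hU : 𝓤 ⊆ L1Density μ (densityY ν h)) (hb : ∀ u ∈ 𝓤, ∃ B : ℝ, ∀ y, |u y| ≤ B)
    {P : ℕ → 𝓧 × 𝓨 → ℝ} (hp : IsProbDensity (ν.prod μ) p)
    (hP : ∀ n, P n ∈ constraintSet ν μ h 𝓤)
    (hlim : Tendsto (fun n => ∫ z, |P n z - p z| ∂(ν.prod μ)) atTop (𝓝 0)) :
    p ∈ constraintSet ν μ h 𝓤 := by
  simp only [mem_constraintSet_iff hh hU] at hP ⊢
  refine ⟨hp, margX_ae_eq_of_tendsto (fun n => (hP n).1.integrable) hp.integrable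
    (fun n => (hP n).2.1) hlim, fun u hu => ?_⟩
  obtain ⟨B, hB⟩ := hb u hu
  have hi : Integrable (fun z => u z.2 * p z) (ν.prod μ) :=
    hp.integrable.bdd_mul ((hU hu).1.comp measurable_snd).aestronglyMeasurable
      (ae_of_all _ fun z => hB z.2)
  refine ⟨hi, ?_⟩
  have h1 : Tendsto (fun n => ∫ z, u z.2 * P n z ∂(ν.prod μ)) atTop
      (𝓝 (∫ z, u z.2 * p z ∂(ν.prod μ))) := by
    refine tendsto_iff_norm_sub_tendsto_zero.2 (squeeze_zero (fun n => norm_nonneg _)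
      (g := fun n => B * ∫ z, |P n z - p z| ∂(ν.prod μ)) (fun n => ?_)
      (by simpa using hlim.const_mul B))
    rw [← integral_sub ((hP n).2.2 u hu).1 hi, ← integral_const_mul]
    have hi2 : Integrable (fun z => |P n z - p z|) (ν.prod μ) :=
      ((hP n).1.integrable.sub hp.integrable).abs
    refine norm_integral_le_of_norm_le (hi2.const_mul B) (ae_of_all _ fun z => ?_)
    rw [← mul_sub, norm_mul]
    exact mul_le_mul_of_nonneg_right (hB z.2) (abs_nonneg _)
  simp only [((hP _).2.2 u hu).2] at h1
  exact tendsto_nhds_unique h1 tendsto_const_nhds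

/-- If the distribution of `Y` is known, the constraint set is closed in variational distance. -/
theorem mem_constraintSet_of_tendsto_of_indicator (hh : IsFullDataDensity ν μ h)
    (h_pos : 0 < probM ν μ h 1)
    (hU : 𝓤 ⊆ L1Density μ (densityY ν h))
    (hind : ∀ A : Set 𝓨, MeasurableSet A → A.indicator (fun _ => (1 : ℝ)) ∈ 𝓤)
    {P : ℕ → 𝓧 × 𝓨 → ℝ} (hp : IsProbDensity (ν.prod μ) p)
    (hP : ∀ n, P n ∈ constraintSet ν μ h 𝓤)
    (hlim : Tendsto (fun n => ∫ z, |P n z - p z| ∂(ν.prod μ)) atTop (𝓝 0)) :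
    p ∈ constraintSet ν μ h 𝓤 := by
  have hq := isProbDensity_condDensity hh h_pos
  -- Indicators in `𝓤` fix the whole `Y`-marginal. Equality of marginals passes to `L¹` limits, and
  -- it yields the constraints for unbounded `u` as well.
  have hY : ∀ n, margY ν (P n) =ᵐ[μ] margY ν (condDensity ν μ h 1) := fun n => by
    refine Integrable.ae_eq_of_forall_setIntegral_eq _ _ (integrable_margY (hP n).1.integrable)
      (integrable_margY hq.integrable) fun A hA _ => ?_
    have h1 := ((hP n).2.2 _ (hind A hA)).2
    have h2 : ∀ k : 𝓨 → ℝ, ∫ y, A.indicator (fun _ => (1 : ℝ)) y * k y ∂μ = ∫ y in A, k y ∂μ :=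
      fun k => by
        rw [← integral_indicator hA]
        refine integral_congr_ae (ae_of_all _ fun y => ?_)
        by_cases hy : y ∈ A <;> simp [hy]
    rwa [h2, h2] at h1
  have hYp := margY_ae_eq_of_tendsto (fun n => (hP n).1.integrable) hp.integrable hY hlim
  refine ⟨hp, margX_ae_eq_of_tendsto (fun n => (hP n).1.integrable) hp.integrable
    (fun n => (hP n).2.1) hlim, fun u hu => ?_⟩
  have hae : (fun y => u y * margY ν (condDensity ν μ h 1) y) =ᵐ[μ]
      fun y => u y * margY ν p y := by
    filter_upwards [hYp] with y hy
    rw [hy]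
  refine ⟨Integrable.congr ?_ hae, integral_congr_ae hae.symm⟩
  exact (integrable_mul_margY_iff hq.measurable hq.nonneg hq.integrable (hU hu).1).2
    (integrable_mul_condDensity hh (hU hu) 1)

/-- Perturbing a density in a bounded direction orthogonal to the additive functions preserves the
constraints. -/
theorem perturb_mem_constraintSet (hh : IsFullDataDensity ν μ h) (h_pos : 0 < probM ν μ h 1)
    (hU : 𝓤 ⊆ L1Density μ (densityY ν h)) (hp : p ∈ constraintSet ν μ h 𝓤) {g : 𝓧 × 𝓨 → ℝ}
    (hg : Measurable g) (hgb : ∀ z, |g z| ≤ 1 / 2)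
    (horth : ∀ w ∈ additiveSpan ν μ h 𝓤, ∫ z, w z * g z * p z ∂(ν.prod μ) = 0) {t : ℝ}
    (ht0 : 0 ≤ t) (ht1 : t ≤ 1) :
    (fun z => p z * (1 + t * g z)) ∈ constraintSet ν μ h 𝓤 := by
  rw [mem_constraintSet_iff hh hU] at hp ⊢
  obtain ⟨hd, hX, hY⟩ := hp
  have hgmul : ∀ k : 𝓧 × 𝓨 → ℝ, Integrable k (ν.prod μ) →
      Integrable (fun z => g z * k z) (ν.prod μ) := fun k hk =>
    hk.bdd_mul hg.aestronglyMeasurable (ae_of_all _ hgb)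
  have hgp := hgmul p hd.integrable
  have heq : (fun z => p z * (1 + t * g z)) = fun z => 1 * p z + t * (g z * p z) := by
    ext z; ring
  -- Indicators of sets in `𝓧` are bounded, hence belong to the additive span; orthogonality to all
  -- of them makes the `X`-marginal of `g * p` vanish.
  have hXg : margX μ (fun z => g z * p z) =ᵐ[ν] 0 := by
    refine Integrable.ae_eq_zero_of_forall_setIntegral_eq_zero (integrable_margX hgp)
      fun A hA _ => ?_
    rw [setIntegral_margX hgp hA]
    have hq := isProbDensity_condDensity hh h_pos
    have hmem : (fun z : 𝓧 × 𝓨 => A.indicator (fun _ => (1 : ℝ)) z.1) ∈ additiveSpan ν μ h 𝓤 := by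
      refine Submodule.subset_span (Or.inl ⟨A.indicator fun _ => 1, ⟨measurable_const.indicator hA,
        ?_⟩, rfl⟩)
      refine (integrable_margX hq.integrable).bdd_mul (c := 1)
        (measurable_const.indicator hA).aestronglyMeasurable (ae_of_all _ fun x => ?_)
      by_cases hx : x ∈ A <;> simp [hx]
    have := horth _ hmem
    simpa only [mul_assoc] using this
  have hgp0 : ∫ z, g z * p z ∂(ν.prod μ) = 0 := by
    have h1 := setIntegral_margX hgp MeasurableSet.univ
    rw [setIntegral_univ, integral_congr_ae hXg] at h1
    simpa using h1.symm
  refine ⟨⟨hd.measurable.mul ((hg.const_mul t).const_add 1), fun z => ?_, ?_, ?_⟩, ?_,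
    fun u hu => ?_⟩
  · have := neg_le_of_abs_le (hgb z)
    exact mul_nonneg (hd.nonneg z) (by nlinarith)
  · rw [heq]
    exact (hd.integrable.const_mul 1).add (hgp.const_mul t)
  · rw [heq, integral_add (hd.integrable.const_mul 1) (hgp.const_mul t), integral_const_mul,
      integral_const_mul, hd.integral_eq_one, hgp0]
    ring
  · rw [heq]
    filter_upwards [margX_add_ae hd.integrable hgp 1 t, hX, hXg] with x h1 h2 h3
    rw [h1, h2, h3]
    simp
  · obtain ⟨hi, he⟩ := hY u hu
    have hi2 := hgmul _ hi
    have hequ : (fun z : 𝓧 × 𝓨 => u z.2 * (p z * (1 + t * g z))) =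
        fun z => u z.2 * p z + t * (g z * (u z.2 * p z)) := by
      ext z; ring
    have h0 : ∫ z, g z * (u z.2 * p z) ∂(ν.prod μ) = 0 := by
      rw [← horth (fun z => u z.2) (Submodule.subset_span (Or.inr ⟨u, hu, rfl⟩))]
      refine integral_congr_ae (ae_of_all _ fun z => ?_)
      simp only
      ring
    rw [hequ]
    refine ⟨hi.add (hi2.const_mul t), ?_⟩
    rw [integral_add hi (hi2.const_mul t), integral_const_mul, h0, he]
    ring

end Constraints

/-! ### Integration against a distribution given by a density -/

section DensityMeasure

variable {Z : Type*} [MeasurableSpace Z] {ρ : Measure Z} {p : Z → ℝ}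

theorem IsProbDensity.isProbabilityMeasure (hp : IsProbDensity ρ p) :
    IsProbabilityMeasure (densityMeasure ρ p) := by
  refine ⟨?_⟩
  rw [densityMeasure, withDensity_apply _ MeasurableSet.univ, setLIntegral_univ,
    ← ofReal_integral_eq_lintegral_ofReal hp.integrable (ae_of_all _ hp.nonneg),
    hp.integral_eq_one, ENNReal.ofReal_one]

theorem IsProbDensity.integrable_densityMeasure_iff (hp : IsProbDensity ρ p) {F : Z → ℝ} :
    Integrable F (densityMeasure ρ p) ↔ Integrable (fun z => F z * p z) ρ := by
  rw [densityMeasure, integrable_withDensity_iff hp.measurable.ennreal_ofReal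
    (ae_of_all _ fun z => ENNReal.ofReal_lt_top)]
  simp only [ENNReal.toReal_ofReal (hp.nonneg _)]

theorem IsProbDensity.integral_densityMeasure (hp : IsProbDensity ρ p) (F : Z → ℝ) :
    ∫ z, F z ∂(densityMeasure ρ p) = ∫ z, F z * p z ∂ρ := by
  rw [densityMeasure, integral_withDensity_eq_integral_toReal_smul hp.measurable.ennreal_ofReal
    (ae_of_all _ fun z => ENNReal.ofReal_lt_top)]
  simp only [ENNReal.toReal_ofReal (hp.nonneg _), smul_eq_mul, mul_comm]

theorem IsProbDensity.ae_densityMeasure_iff (hp : IsProbDensity ρ p) {Q : Z → Prop} :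
    (∀ᵐ z ∂(densityMeasure ρ p), Q z) ↔ ∀ᵐ z ∂ρ, 0 < p z → Q z := by
  rw [densityMeasure, ae_withDensity_iff hp.measurable.ennreal_ofReal]
  simp only [ne_eq, ENNReal.ofReal_eq_zero, not_le]

end DensityMeasure

/-! ### The full-data density built from a projection -/

section FullData

variable {𝓧 𝓨 : Type*} [MeasurableSpace 𝓧] [MeasurableSpace 𝓨]
  {ν : Measure 𝓧} {μ : Measure 𝓨} {h : 𝓧 × 𝓨 → Fin 2 → ℝ} {𝓤 : Set (𝓨 → ℝ)} {p : 𝓧 × 𝓨 → ℝ}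

theorem buildFullData_zero (z : 𝓧 × 𝓨) : buildFullData ν μ h p z 0 = h z 0 := by
  simp [buildFullData]

theorem buildFullData_one (z : 𝓧 × 𝓨) : buildFullData ν μ h p z 1 = p z * probM ν μ h 1 := by
  simp [buildFullData]

theorem isFullDataDensity_buildFullData (hh : IsFullDataDensity ν μ h) (h_pos : 0 < probM ν μ h 1)
    (hp : IsProbDensity (ν.prod μ) p) : IsFullDataDensity ν μ (buildFullData ν μ h p) where
  measurable := Fin.forall_fin_two.2
    ⟨by simpa only [buildFullData_zero] using hh.measurable 0,
      by simpa only [buildFullData_one] using hp.measurable.mul_const _⟩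
  nonneg z := Fin.forall_fin_two.2
    ⟨by simpa only [buildFullData_zero] using hh.nonneg z 0,
      by simpa only [buildFullData_one] using mul_nonneg (hp.nonneg z) h_pos.le⟩
  integrable := Fin.forall_fin_two.2
    ⟨by simpa only [buildFullData_zero] using hh.integrable 0,
      by simpa only [buildFullData_one] using hp.integrable.mul_const _⟩
  integral_eq_one := by
    rw [Fin.sum_univ_two]
    simp only [buildFullData_zero, buildFullData_one]
    rw [integral_mul_const, hp.integral_eq_one, one_mul]
    have := probM_zero hh
    rw [probM] at this
    linarith

theorem missProb_buildFullData (z : 𝓧 × 𝓨) : missProb (buildFullData ν μ h p) z =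
    p z * probM ν μ h 1 / (h z 0 + p z * probM ν μ h 1) := by
  rw [missProb, Fin.sum_univ_two, buildFullData_zero, buildFullData_one]

/-- Bayes' rule gives `π p / ((1 - π) q + π p)`; dividing by `π q` leaves `r / (c + r)` with `r = p
/ q`. This is what the value of `c` is for. -/
theorem missProb_buildFullData_eq_ratio (hh : IsFullDataDensity ν μ h)
    (h_pos : 0 < probM ν μ h 1) (h_lt : probM ν μ h 1 < 1) {c : ℝ}
    (hc : c = (1 - probM ν μ h 1) / probM ν μ h 1) {z : 𝓧 × 𝓨}
    (hq : condDensity ν μ h 0 z ≠ 0) (hp : 0 ≤ p z) :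
    missProb (buildFullData ν μ h p) z =
      p z / condDensity ν μ h 0 z / (c + p z / condDensity ν μ h 0 z) := by
  have h0 : 0 < 1 - probM ν μ h 1 := sub_pos.2 h_lt
  have hz : 0 < h z 0 := by
    refine lt_of_le_of_ne (hh.nonneg z 0) fun he => hq ?_
    simp [condDensity, ← he]
  rw [missProb_buildFullData, hc]
  simp only [condDensity]
  rw [probM_zero hh]
  have h1 : 0 < h z 0 + p z * probM ν μ h 1 := by positivity
  rw [div_eq_div_iff h1.ne' (by positivity)]
  field_simp

/-- Almost everywhere under the distribution with density `p` one has `p > 0`, and domination then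
forces `h z 0 > 0`. -/
theorem missProb_buildFullData_mem_Ioo (hh : IsFullDataDensity ν μ h)
    (h_pos : 0 < probM ν μ h 1) (hp : IsProbDensity (ν.prod μ) p)
    (hdom : ∀ᵐ z ∂(ν.prod μ), condDensity ν μ h 0 z = 0 → p z = 0) :
    ∀ᵐ z ∂(densityMeasure (ν.prod μ) p), missProb (buildFullData ν μ h p) z ∈ Ioo (0 : ℝ) 1 := by
  rw [hp.ae_densityMeasure_iff]
  filter_upwards [hdom] with z hz hpz
  have h0 : 0 < h z 0 := by
    refine lt_of_le_of_ne (hh.nonneg z 0) fun he => hpz.ne' (hz ?_)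
    simp [condDensity, ← he]
  rw [missProb_buildFullData]
  refine ⟨by positivity, ?_⟩
  rw [div_lt_one (by positivity)]
  linarith

theorem obsEquivalent_buildFullData (h_pos : 0 < probM ν μ h 1)
    (hX : ∀ᵐ x ∂ν, margX μ p x = margX μ (condDensity ν μ h 1) x) :
    ObsEquivalent ν μ (buildFullData ν μ h p) h := by
  refine ⟨ae_of_all _ fun z => by simp [obsDensity, buildFullData_zero], ?_⟩
  filter_upwards [hX] with x hx
  simp only [obsDensity, buildFullData_one]
  simp only [margX, condDensity] at hx
  rw [integral_mul_const, hx, integral_div, div_mul_cancel₀ _ h_pos.ne']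

variable [SigmaFinite ν] [SigmaFinite μ]

theorem integral_mul_densityY_buildFullData (hh : IsFullDataDensity ν μ h)
    (h_pos : 0 < probM ν μ h 1) (hU : 𝓤 ⊆ L1Density μ (densityY ν h))
    (hp : p ∈ constraintSet ν μ h 𝓤) {u : 𝓨 → ℝ} (hu : u ∈ 𝓤) :
    Integrable (fun y => u y * densityY ν (buildFullData ν μ h p) y) μ ∧
      ∫ y, u y * densityY ν (buildFullData ν μ h p) y ∂μ = ∫ y, u y * densityY ν h y ∂μ := by
  rw [mem_constraintSet_iff hh hU] at hp
  obtain ⟨hd, -, hY⟩ := hp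
  obtain ⟨hi, he⟩ := hY u hu
  have hb := isFullDataDensity_buildFullData hh h_pos hd
  have h0 := integrable_mul_density hh (hU hu) 0
  have h1 := integrable_mul_density hh (hU hu) 1
  have hsum : ∀ k : 𝓧 × 𝓨 → Fin 2 → ℝ, (fun z : 𝓧 × 𝓨 => u z.2 * ∑ m, k z m) =
      fun z => u z.2 * k z 0 + u z.2 * k z 1 := fun k => by
    ext z; rw [Fin.sum_univ_two, mul_add]
  have hbi : Integrable (fun z : 𝓧 × 𝓨 => u z.2 * ∑ m, buildFullData ν μ h p z m) (ν.prod μ) := by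
    rw [hsum]
    simp only [buildFullData_zero, buildFullData_one, ← mul_assoc]
    exact h0.add (hi.mul_const _)
  have hhi : Integrable (fun z : 𝓧 × 𝓨 => u z.2 * ∑ m, h z m) (ν.prod μ) := by
    rw [hsum]
    exact h0.add h1
  refine ⟨(integrable_mul_margY_iff (p := fun z => ∑ m, buildFullData ν μ h p z m)
    (Finset.measurable_fun_sum _ fun m _ => hb.measurable m)
    (fun z => Finset.sum_nonneg fun m _ => hb.nonneg z m)
    (integrable_finsetSum _ fun m _ => hb.integrable m) (hU hu).1).2 hbi, ?_⟩
  rw [densityY, densityY, integral_mul_margY hbi, integral_mul_margY hhi, hsum, hsum]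
  simp only [buildFullData_zero, buildFullData_one, ← mul_assoc]
  rw [integral_add h0 (hi.mul_const _), integral_add h0 h1, integral_mul_const, he]
  simp only [condDensity, ← mul_div_assoc]
  rw [integral_div, div_mul_cancel₀ _ h_pos.ne']

theorem integrable_of_mem_additiveSpan (hh : IsFullDataDensity ν μ h)
    (hU : 𝓤 ⊆ L1Density μ (densityY ν h)) (hp : p ∈ constraintSet ν μ h 𝓤) {w : 𝓧 × 𝓨 → ℝ}
    (hw : w ∈ additiveSpan ν μ h 𝓤) : Integrable w (densityMeasure (ν.prod μ) p) := by
  rw [mem_constraintSet_iff hh hU] at hp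
  obtain ⟨hd, hX, hY⟩ := hp
  induction hw using Submodule.span_induction with
  | mem w hw =>
    rw [hd.integrable_densityMeasure_iff]
    rcases hw with ⟨α, ⟨hαm, hα⟩, rfl⟩ | ⟨u, hu, rfl⟩
    · refine (integrable_mul_margX_iff hd.measurable hd.nonneg hd.integrable hαm).1 (hα.congr ?_)
      filter_upwards [hX] with x hx
      rw [hx]
    · exact (hY u hu).1
  | zero => exact integrable_zero _ _ _
  | add w w' _ _ hw hw' => exact hw.add hw'
  | smul r w _ hw => exact hw.smul r

/-- The first order condition for a projection: the link of the missingness mechanism is a limit of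
additive functions. -/
theorem memL1Closure_lam_missProb (hh : IsFullDataDensity ν μ h) (h_pos : 0 < probM ν μ h 1)
    (h_lt : probM ν μ h 1 < 1) (hU : 𝓤 ⊆ L1Density μ (densityY ν h)) {lam : ℝ → ℝ}
    (hl : IsRegularLink lam) {c : ℝ} (hc : c = (1 - probM ν μ h 1) / probM ν μ h 1)
    (hd : FLinkDefined lam c) (hgr : GrowthCondition (fLink lam c))
    (hproj : IsFProjection (fLink lam c) (ν.prod μ) (condDensity ν μ h 0)
      (constraintSet ν μ h 𝓤) p)
    (hF : HasFiniteDivergence (fLink lam c) (ν.prod μ) p (condDensity ν μ h 0)) :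
    MemL1Closure (densityMeasure (ν.prod μ) p) (additiveSpan ν μ h 𝓤)
      (fun z => lam (missProb (buildFullData ν μ h p) z)) := by
  have hp : IsProbDensity (ν.prod μ) p := hproj.1.1
  have hq : IsProbDensity (ν.prod μ) (condDensity ν μ h 0) :=
    isProbDensity_condDensity hh (by rw [probM_zero hh]; linarith)
  have hc0 : 0 < c := by
    rw [hc]
    exact div_pos (sub_pos.2 h_lt) h_pos
  set q := condDensity ν μ h 0 with hqdef
  -- Where `q = 0`, domination gives `p = 0` and both sides vanish, so the value of `lam` there is
  -- irrelevant.
  have hlam : (fun z => lam (p z / q z / (c + p z / q z)) * (p z / q z) * q z) =ᵐ[ν.prod μ]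
      fun z => lam (missProb (buildFullData ν μ h p) z) * p z := by
    filter_upwards [hF.1] with z hz
    by_cases hqz : q z = 0
    · simp [hqz, hz hqz]
    · rw [missProb_buildFullData_eq_ratio hh h_pos h_lt hc hqz (hp.nonneg z), mul_assoc,
        div_mul_cancel₀ _ hqz]
  have hFi : Integrable (fun z => lam (missProb (buildFullData ν μ h p) z))
      (densityMeasure (ν.prod μ) p) := by
    rw [hp.integrable_densityMeasure_iff]
    refine Integrable.congr ?_ hlam
    simpa only [one_mul] using hF.integrable_lam hl hc0 hd hgr hq hp one_pos
  have := hp.isProbabilityMeasure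
  by_contra hn
  obtain ⟨g, hgm, ⟨B, hB⟩, horth, hne⟩ := exists_bounded_of_not_memL1Closure
    (fun w hw => integrable_of_mem_additiveSpan hh hU hproj.1 hw) hFi hn
  -- Both directions `± g`, scaled to be at most `1/2`, are admissible.
  have hnonneg : ∀ k : ℝ, |k| * (|B| + 1) ≤ 1 / 2 →
      0 ≤ k * ∫ z, lam (missProb (buildFullData ν μ h p) z) * g z
        ∂(densityMeasure (ν.prod μ) p) := fun k hk => by
    have hgb : ∀ z, |k * g z| ≤ 1 / 2 := fun z => by
      rw [abs_mul]
      refine le_trans ?_ hk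
      gcongr
      exact (hB z).trans ((le_abs_self B).trans (by linarith))
    have h1 := hF.integral_lam_mul_nonneg hl hc0 hd hgr hq hp (hgm.const_mul k) hgb
      fun t ht0 ht1 => by
        have hmem := perturb_mem_constraintSet hh h_pos hU hproj.1 (hgm.const_mul k) hgb
          (fun w hw => by
            have h2 := horth w hw
            rw [hp.integral_densityMeasure] at h2
            have h3 : (fun z => w z * (k * g z) * p z) = fun z => k * (w z * g z * p z) := by
              ext z; ring
            rw [h3, integral_const_mul, h2, mul_zero]) ht0.le ht1
        have h2 := hproj.2 _ hmem
        have hFt := hF.mul_bounded hl hc0 hd hgr hq hp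
          (s := fun z => 1 + t * (k * g z)) (((hgm.const_mul k).const_mul t).const_add 1)
          (fun z => by have := neg_le_of_abs_le (hgb z); nlinarith)
          (fun z => by have := le_of_abs_le (hgb z); nlinarith)
        rwa [hF.fDivergence_eq, hFt.fDivergence_eq, EReal.coe_le_coe_iff] at h2
    rw [hp.integral_densityMeasure, ← integral_const_mul]
    refine h1.trans_eq (integral_congr_ae ?_)
    filter_upwards [hlam] with z hz
    rw [hz]
    ring
  have hk : 0 < 1 / (2 * (|B| + 1)) := by positivity
  have hkB : 1 / (2 * (|B| + 1)) * (|B| + 1) = 1 / 2 := by field_simp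
  have h1 := hnonneg (1 / (2 * (|B| + 1))) (by rw [abs_of_pos hk, hkB])
  have h2 := hnonneg (-(1 / (2 * (|B| + 1)))) (by rw [abs_neg, abs_of_pos hk, hkB])
  -- Nonnegativity in both directions makes the integral zero, against the separation `hne`.
  refine hne (le_antisymm ?_ (nonneg_of_mul_nonneg_right h1 hk))
  rw [neg_mul] at h2
  exact nonpos_of_mul_nonpos_right (by linarith) hk

end FullData

theorem theorem2 {𝓧 𝓨 : Type*} [MeasurableSpace 𝓧] [MeasurableSpace 𝓨]
    (ν : Measure 𝓧) (μ : Measure 𝓨) [SigmaFinite ν] [SigmaFinite μ]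
    -- the full-data density, with both `M = 0` and `M = 1` possible
    (h : 𝓧 × 𝓨 → Fin 2 → ℝ) (hh : IsFullDataDensity ν μ h)
    (h_pos : 0 < probM ν μ h 1) (h_lt : probM ν μ h 1 < 1)
    -- the auxiliary functions
    (𝓤 : Set (𝓨 → ℝ)) (hU : 𝓤 ⊆ L1Density μ (densityY ν h))
    -- the link function
    (lam : ℝ → ℝ) (h_link : IsRegularLink lam)
    (c : ℝ) (hc : c = (1 - probM ν μ h 1) / probM ν μ h 1)
    (h_def : FLinkDefined lam c) (h_growth : GrowthCondition (fLink lam c))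
    -- the infimum of the divergence over the constraint set is finite
    (h_fin : ∃ p ∈ constraintSet ν μ h 𝓤,
      fDivergence (fLink lam c) (ν.prod μ) p (condDensity ν μ h 0) < ⊤) :
    -- existence of the projection
    (Tendsto lam (𝓝[<] 1) atTop →
      SublevelsClosedInVariation (fLink lam c) (ν.prod μ) (condDensity ν μ h 0)
        (constraintSet ν μ h 𝓤) →
      ∃ p, IsFProjection (fLink lam c) (ν.prod μ) (condDensity ν μ h 0)
        (constraintSet ν μ h 𝓤) p) ∧
    -- the closedness holds for bounded functions and for a known distribution of `Y`
    ((∀ u ∈ 𝓤, ∃ B : ℝ, ∀ y, |u y| ≤ B) ∨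
        (∀ A : Set 𝓨, MeasurableSet A → A.indicator (fun _ => (1 : ℝ)) ∈ 𝓤) →
      SublevelsClosedInVariation (fLink lam c) (ν.prod μ) (condDensity ν μ h 0)
        (constraintSet ν μ h 𝓤)) ∧
    -- uniqueness of the projection
    (∀ p p', IsFProjection (fLink lam c) (ν.prod μ) (condDensity ν μ h 0)
        (constraintSet ν μ h 𝓤) p →
      IsFProjection (fLink lam c) (ν.prod μ) (condDensity ν μ h 0)
        (constraintSet ν μ h 𝓤) p' →
      p =ᵐ[ν.prod μ] p') ∧
    -- the full-data density `g` built from the projection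
    (∀ p, IsFProjection (fLink lam c) (ν.prod μ) (condDensity ν μ h 0)
        (constraintSet ν μ h 𝓤) p →
      IsFullDataDensity ν μ (buildFullData ν μ h p) ∧
      (∀ᵐ z ∂(densityMeasure (ν.prod μ) p), missProb (buildFullData ν μ h p) z ∈ Ioo (0 : ℝ) 1) ∧
      MemL1Closure (densityMeasure (ν.prod μ) p) (additiveSpan ν μ h 𝓤)
        (fun z => lam (missProb (buildFullData ν μ h p) z)) ∧
      ObsEquivalent ν μ (buildFullData ν μ h p) h ∧
      ∀ u ∈ 𝓤, Integrable (fun y => u y * densityY ν (buildFullData ν μ h p) y) μ ∧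
        ∫ y, u y * densityY ν (buildFullData ν μ h p) y ∂μ = ∫ y, u y * densityY ν h y ∂μ) := by
  have hc0 : 0 < c := by
    rw [hc]
    exact div_pos (sub_pos.2 h_lt) h_pos
  have hq : IsProbDensity (ν.prod μ) (condDensity ν μ h 0) :=
    isProbDensity_condDensity hh (by rw [probM_zero hh]; linarith)
  have hcont := continuousOn_fLink h_link hc0 h_def
  have hconv := strictConvexOn_fLink h_link hc0 h_def
  have hC : ∀ p ∈ constraintSet ν μ h 𝓤, IsProbDensity (ν.prod μ) p := fun p hp => hp.1
  have hmid : ∀ p ∈ constraintSet ν μ h 𝓤, ∀ p' ∈ constraintSet ν μ h 𝓤,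
      (fun z => (p z + p' z) / 2) ∈ constraintSet ν μ h 𝓤 := fun p hp p' hp' =>
    midpoint_mem_constraintSet hh hU hp hp'
  refine ⟨fun hlim hclosed => ?_, ?_, fun p p' hp hp' => ?_, fun p hp => ?_⟩
  · exact exists_isFProjection hcont hconv (fLink_superlinear h_link hc0 h_def hlim) hq hC hmid
      h_fin hclosed
  · rintro (hb | hind) K P p hp hP hlim
    · exact mem_constraintSet_of_tendsto_of_bounded hh hU hb hp (fun n => (hP n).1) hlim
    · exact mem_constraintSet_of_tendsto_of_indicator hh h_pos hU hind hp (fun n => (hP n).1) hlim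
  · obtain ⟨A, B, -, hB, hlow⟩ := exists_affine_le_fLink h_link hc0 h_def
    exact IsFProjection.ae_eq hcont hconv hB hlow hq hC hmid h_fin hp hp'
  · obtain ⟨p₀, hp₀, hlt⟩ := h_fin
    -- Finiteness of the infimum passes to the minimizer, which is therefore dominated by `q`.
    have hF := hasFiniteDivergence_of_lt_top ((hp.2 p₀ hp₀).trans_lt hlt)
    exact ⟨isFullDataDensity_buildFullData hh h_pos hp.1.1,
      missProb_buildFullData_mem_Ioo hh h_pos hp.1.1 hF.1,
      memL1Closure_lam_missProb hh h_pos h_lt hU h_link hc h_def h_growth hp hF,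
      obsEquivalent_buildFullData h_pos hp.1.2.1,
      fun u hu => integral_mul_densityY_buildFullData hh h_pos hU hp.1 hu⟩
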